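/- All graphs are finite, simple and undirected. $S_{1,2,4}$ is the tree consisting of a center $u$ and three paths $(u,a_1)$, $(u,b_1,b_2)$, $(u,c_1,c_2,c_3,c_4)$ that share only $u$; a graph is $S_{1,2,4}$-free if it has no induced subgraph isomorphic to $S_{1,2,4}$. Let $G=(V,E)$ be a graph and $xy\in E$. For $i\ge 1$ let $N_i$ be the set of vertices at distance exactly $i$ from $\{x,y\}$, and let $X=\{x,y\}\cup N_1\cup N_2\cup N_3$, $Y=V\setminus X$. For $u\in N_2$ let $T_u$ be the set of vertices in $N_3$ whose only neighbor in $N_2$ is $u$; an *in-vertex* of $T_u$ is a vertex of $T_u$ with no neighbor in $N_3\setminus T_u$ and no neighbor in $N_4$. A *feasible $xy$-coloring* of $G[X]$ is a coloring of all vertices of $X$ black or white such that 1. $x$ and $y$ are black, the white vertices are independent, and every black vertex has exactly one black neighbor in $X$; 2. the colors forced on $N_4$ (a vertex of $N_4$ becomes black if it has a white neighbor in $N_3$, and white if it has a black neighbor in $N_3$) lead to no contradiction: no vertex of $N_4$ receives both colors, and in the resulting partial coloring of $X\cup N_4$ the white vertices are independent and every black vertex has at most one black neighbor; 3. no black vertex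 of $N_4$ is isolated in $G[Y]$. **Lemma.** There are a polynomial $p$ and an algorithm whose running time is bounded by a polynomial in $|V|$ such that the following holds for every $S_{1,2,4}$-free graph $G$ and every edge $xy$ of $G$ for which $T_u$ has at most one in-vertex for every $u\in N_2$ that is isolated in $G[N_2]$: the number of feasible $xy$-colorings of $G[X]$ is at most $p(|V|)$, and the algorithm, given the adjacency matrix of $G$ and the vertices $x,y$, outputs all feasible $xy$-colorings of $G[X]$, each exactly once. -/

import Mathlib

/-! ### Graphs, distance levels and colorings -/

/-- The spider `S_{1,2,4}`: center `0`, with the three legs `1`, `2 3` and `4 5 6 7`. -/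
def spider124 : SimpleGraph (Fin 8) :=
  SimpleGraph.fromEdgeSet {s(0, 1), s(0, 2), s(2, 3), s(0, 4), s(4, 5), s(5, 6), s(6, 7)}

/-- `G` has no induced subgraph isomorphic to `S_{1,2,4}`. -/
def IsSpider124Free {V : Type*} (G : SimpleGraph V) : Prop :=
  ¬ spider124.IsIndContained G

section Coloring

variable {V : Type*} (G : SimpleGraph V)

/-- The distance level `N_i` of the pair `xy`: the vertices at distance exactly `i` from `{x, y}`.
Extended distances are used, so vertices in other components of `G` lie in no level. -/
def level (x y : V) (i : ℕ) : Set V :=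
  {z | min (G.edist z x) (G.edist z y) = (i : ℕ∞)}

/-- `X = {x, y} ∪ N_1 ∪ N_2 ∪ N_3`. -/
def levelX (x y : V) : Set V :=
  {x, y} ∪ level G x y 1 ∪ level G x y 2 ∪ level G x y 3

/-- `Y = V \ X`. -/
def levelY (x y : V) : Set V := (levelX G x y)ᶜ

/-- A partial black-white coloring of `G` (black set `B`, white set `W`, the remaining vertices
uncolored) is feasible: no vertex has both colors, the white vertices are independent, and every
black vertex has at most one black neighbor. -/
structure IsFeasiblePartial (B W : Set V) : Prop where
  disjoint : Disjoint B W
  white_indep : G.IsIndepSet W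
  black_le_one : ∀ v ∈ B, {w | w ∈ B ∧ G.Adj v w}.Subsingleton

/-- A complete black-white coloring of the induced subgraph `G[U]` (black set `B`, white set
`U \ B`) is feasible: the white vertices are independent, and every black vertex has exactly one
black neighbor. -/
structure IsFeasibleOn (U B : Set V) : Prop where
  subset : B ⊆ U
  white_indep : G.IsIndepSet (U \ B)
  black_one : ∀ v ∈ B, ∃! w, w ∈ B ∧ G.Adj v w

/-- The vertices of `N_4` that become black under a coloring of `X` with black set `B`:
those with a white neighbor in `N_3`. -/
def forcedBlack (x y : V) (B : Set V) : Set V :=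
  {z | z ∈ level G x y 4 ∧ ∃ t ∈ level G x y 3, t ∉ B ∧ G.Adj t z}

/-- The vertices of `N_4` that become white under a coloring of `X` with black set `B`:
those with a black neighbor in `N_3`. -/
def forcedWhite (x y : V) (B : Set V) : Set V :=
  {z | z ∈ level G x y 4 ∧ ∃ t ∈ level G x y 3, t ∈ B ∧ G.Adj t z}

/-- Feasible `xy`-colorings of `G[X]`, given by their set `B` of black vertices (the white vertices
are those of `X \ B`): complete feasible colorings of `G[X]` with `x` and `y` black for which the
colors forced on `N_4` lead to no contradiction, that is, together with these colors one has a
feasible partial coloring, and no black vertex of `N_4` is isolated in `G[Y]` (it could not get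
a black neighbor). -/
structure IsFeasibleXYColoring (x y : V) (B : Set V) : Prop where
  x_black : x ∈ B
  y_black : y ∈ B
  feasible : IsFeasibleOn G (levelX G x y) B
  extends_to_level_four :
    IsFeasiblePartial G (B ∪ forcedBlack G x y B) ((levelX G x y \ B) ∪ forcedWhite G x y B)
  not_isolated : ∀ z ∈ forcedBlack G x y B, ∃ z' ∈ levelY G x y, G.Adj z z'

/-- For `u ∈ N_2`, the set `T_u` of private neighbors of `u` in `N_3`: the vertices of `N_3` whose
only neighbor in `N_2` is `u`. -/
def privateNeighbors (x y u : V) : Set V :=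
  {t | t ∈ level G x y 3 ∧ {w | w ∈ level G x y 2 ∧ G.Adj t w} = {u}}

/-- The in-vertices of `T_u`: those with no neighbor in `N_3 \ T_u` and no neighbor in `N_4`. -/
def inVertices (x y u : V) : Set V :=
  {t | t ∈ privateNeighbors G x y u ∧
    (∀ s ∈ level G x y 3, s ∉ privateNeighbors G x y u → ¬ G.Adj t s) ∧
    ∀ s ∈ level G x y 4, ¬ G.Adj t s}

/-- For every `u` isolated in `G[N_2]`, the set `T_u` has at most one in-vertex. -/
def AtMostOneInVertex (x y : V) : Prop :=
  ∀ u ∈ level G x y 2, (∀ w ∈ level G x y 2, ¬ G.Adj u w) → (inVertices G x y u).Subsingleton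

end Coloring

/-! ### Machine model

Structured programs for a random access machine with unit cost. The memory consists of
two-dimensional arrays of natural numbers, and the arithmetic is addition and truncated
subtraction only (no multiplication), so that a computation of `t` steps only creates numbers of
`O(t)` bits beyond the input, and polynomial time is the usual notion. -/

/-- Memory contents: `s a i j` is the entry at position `(i, j)` of array number `a`. -/
abbrev Store := ℕ → ℕ → ℕ → ℕ

/-- Expressions: constants, array entries, sums, truncated differences. -/
inductive Expr where
  | num (c : ℕ) : Expr
  | get (a : ℕ) (i j : Expr) : Expr
  | add (e f : Expr) : Expr
  | sub (e f : Expr) : Expr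

/-- Value of an expression. -/
def Expr.eval (s : Store) : Expr → ℕ
  | .num c => c
  | .get a i j => s a (i.eval s) (j.eval s)
  | .add e f => e.eval s + f.eval s
  | .sub e f => e.eval s - f.eval s

/-- Time to evaluate an expression: the number of its constituents. -/
def Expr.cost : Expr → ℕ
  | .num _ => 1
  | .get _ i j => i.cost + j.cost + 1
  | .add e f => e.cost + f.cost + 1
  | .sub e f => e.cost + f.cost + 1

/-- Programs. A test of an expression succeeds when its value is nonzero. -/
inductive Prog where
  | skip : Prog
  | set (a : ℕ) (i j e : Expr) : Prog
  | seq (p q : Prog) : Prog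
  | ite (e : Expr) (p q : Prog) : Prog
  | loop (e : Expr) (p : Prog) : Prog

/-- The store after writing `v` to position `(i, j)` of array `a`. -/
def Store.write (s : Store) (a i j v : ℕ) : Store :=
  fun a' i' j' => if a' = a ∧ i' = i ∧ j' = j then v else s a' i' j'

/-- `Exec p s t s'`: started on the store `s`, the program `p` halts after exactly `t` steps with
the store `s'`. -/
inductive Exec : Prog → Store → ℕ → Store → Prop where
  | skip (s : Store) : Exec .skip s 1 s
  | set (a : ℕ) (i j e : Expr) (s : Store) :
      Exec (.set a i j e) s (i.cost + j.cost + e.cost + 1)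
        (s.write a (i.eval s) (j.eval s) (e.eval s))
  | seq {p q : Prog} {s s' s'' : Store} {t t' : ℕ} (hp : Exec p s t s') (hq : Exec q s' t' s'') :
      Exec (.seq p q) s (t + t' + 1) s''
  | iteTrue {e : Expr} {p q : Prog} {s s' : Store} {t : ℕ} (he : e.eval s ≠ 0)
      (hp : Exec p s t s') : Exec (.ite e p q) s (e.cost + t + 1) s'
  | iteFalse {e : Expr} {p q : Prog} {s s' : Store} {t : ℕ} (he : e.eval s = 0)
      (hq : Exec q s t s') : Exec (.ite e p q) s (e.cost + t + 1) s'
  | loopDone {e : Expr} {p : Prog} {s : Store} (he : e.eval s = 0) :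
      Exec (.loop e p) s (e.cost + 1) s
  | loopStep {e : Expr} {p : Prog} {s s' s'' : Store} {t t' : ℕ} (he : e.eval s ≠ 0)
      (hp : Exec p s t s') (hl : Exec (.loop e p) s' t' s'') :
      Exec (.loop e p) s (e.cost + t + t' + 1) s''

open Classical in
/-- The input: array `0` is the adjacency matrix of the graph, and the entries `(0, 0)`, `(0, 1)`,
`(0, 2)` of array `1` are the number of vertices, `x` and `y`; all other entries are `0`. -/
noncomputable def inputStore {n : ℕ} (G : SimpleGraph (Fin n)) (x y : Fin n) : Store :=
  fun a i j =>
    if a = 0 then (if ∃ (hi : i < n) (hj : j < n), G.Adj ⟨i, hi⟩ ⟨j, hj⟩ then 1 else 0)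
    else if a = 1 ∧ i = 0 then
      (if j = 0 then n else if j = 1 then (x : ℕ) else if j = 2 then (y : ℕ) else 0)
    else 0

/-- The number of sets in the output: entry `(0, 0)` of array `2`. -/
def outputLength (s : Store) : ℕ := s 2 0 0

/-- The `k`-th set in the output: row `k` of array `3`, as an indicator vector. -/
def outputSet (n : ℕ) (s : Store) (k : ℕ) : Set (Fin n) := {v | s 3 k v = 1}

/-! ### Spiders -/

/-! In a feasible coloring $N_1$ is white and $N_2$ is black, since $x$ and $y$ are each other's
only black neighbor. So a black vertex of $N_3$ lies in some $T_u$ with $u$ isolated in $G[N_2]$,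
each such $T_u$ contains exactly one black vertex, and every edge from $N_3$ to $N_3\cup N_4$ has
ends of different colors (`IsLayerColoring`). Read as propagation rules (`stepBlack`, `stepWhite`),
these facts recover the coloring in three rounds from few seeds (`IsLayerColoring.exists_seeds`).
Since $T_u$ has at most one in-vertex, it suffices to reach those vertices of $T_u$ that have a
neighbor in $N_4$ or in $N_3\setminus T_u$; a single remaining vertex follows from the others.

If there is a fork at $v$, that is, nonadjacent $s,s'\in T_v$ and a vertex $q$ attached to $s'$ but
not to $s$, then $v$ with the legs $s$ and $s',q$ is most of a spider. Its absence forces each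
isolated $u\ne v$ not adjacent to $q$ to share a neighbor $w\in N_1$ with $v$. Now $w,u,t,r$ must
fail as the long leg for every edge $tr$ leaving $T_u$, and each way of failing makes $t$ known
(`Fork.known`).

If there is no fork, a vertex $u$ without a tail (an induced path $u,t,q,r$ going deeper) needs no
seeds. A tail makes all $u'$ that share a neighbor in $N_1$ with $u$ known at the cost of six seeds,
and among the vertices reached through the same $a\in\{x,y\}$ two tails suffice. This gives $2\cdot
2\cdot 6=24$ seeds.

A coloring is thus coded by 24 vertices, 24 color flags and a pair $q,p$ declaring the neighbors of
$q$ in $N_4$ other than $p$ white, so there are at most $|V|^{50}$ colorings. The algorithm runs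
through all 50-tuples and outputs the decoded set if it is feasible and no lexicographically smaller
tuple decodes to it. These tests are first-order formulas with a fixed number of quantifiers, each a
loop over the vertices (`PolyDec`). -/

theorem spider124_adj_injective :
    ∀ i j : Fin 8, (∀ k, spider124.Adj i k ↔ spider124.Adj j k) → i = j := by
  have hF : ∀ i j, spider124.Adj i j ↔ s(i, j) ∈ ({s(0, 1), s(0, 2), s(2, 3), s(0, 4), s(4, 5),
      s(5, 6), s(6, 7)} : Finset (Sym2 (Fin 8))) ∧ i ≠ j := fun i j => by
    simp [spider124]
  simp only [hF]
  decide

theorem IsSpider124Free.false_of_spider {V : Type*} {G : SimpleGraph V} (hG : IsSpider124Free G)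
    {c a b₁ b₂ d₁ d₂ d₃ d₄ : V}
    (h01 : G.Adj c a) (h02 : G.Adj c b₁) (h23 : G.Adj b₁ b₂) (h04 : G.Adj c d₁)
    (h45 : G.Adj d₁ d₂) (h56 : G.Adj d₂ d₃) (h67 : G.Adj d₃ d₄)
    (n03 : ¬ G.Adj c b₂) (n05 : ¬ G.Adj c d₂) (n06 : ¬ G.Adj c d₃) (n07 : ¬ G.Adj c d₄)
    (n12 : ¬ G.Adj a b₁) (n13 : ¬ G.Adj a b₂) (n14 : ¬ G.Adj a d₁) (n15 : ¬ G.Adj a d₂)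
    (n16 : ¬ G.Adj a d₃) (n17 : ¬ G.Adj a d₄)
    (n24 : ¬ G.Adj b₁ d₁) (n25 : ¬ G.Adj b₁ d₂) (n26 : ¬ G.Adj b₁ d₃) (n27 : ¬ G.Adj b₁ d₄)
    (n34 : ¬ G.Adj b₂ d₁) (n35 : ¬ G.Adj b₂ d₂) (n36 : ¬ G.Adj b₂ d₃) (n37 : ¬ G.Adj b₂ d₄)
    (n46 : ¬ G.Adj d₁ d₃) (n47 : ¬ G.Adj d₁ d₄) (n57 : ¬ G.Adj d₂ d₄) : False := by
  let f : Fin 8 → V := ![c, a, b₁, b₂, d₁, d₂, d₃, d₄]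
  have hadj : ∀ i j, G.Adj (f i) (f j) ↔ spider124.Adj i j := by
    intro i j
    fin_cases i <;> fin_cases j <;>
      simp [f, spider124, h01, h02, h23, h04, h45, h56, h67, n03, n05, n06, n07, n12, n13, n14,
        n15, n16, n17, n24, n25, n26, n27, n34, n35, n36, n37, n46, n47, n57,
        h01.symm, h02.symm, h23.symm, h04.symm, h45.symm, h56.symm, h67.symm, G.adj_comm b₂,
        G.adj_comm b₁ a, G.adj_comm d₁, G.adj_comm d₂, G.adj_comm d₃, G.adj_comm d₄]
  -- No two vertices of the spider have the same neighborhood, so distinctness of the eight vertices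
  -- is automatic.
  have hinj : Function.Injective f := fun i j hij =>
    spider124_adj_injective i j fun k => by rw [← hadj, ← hadj, hij]
  exact hG ⟨⟨⟨f, hinj⟩, fun {i j} => hadj i j⟩⟩

/-! ### Layers -/

/-- The distance to `{x, y}`, truncated at `5`. -/
noncomputable def depth {V : Type*} (G : SimpleGraph V) (x y v : V) : ℕ :=
  (min (min (G.edist v x) (G.edist v y)) 5).toNat

/-- `L` behaves like the distance to `{x, y}`, truncated at `5`. -/
structure IsLayering {V : Type*} (G : SimpleGraph V) (x y : V) (L : V → ℕ) : Prop where
  le_of_adj : ∀ {a b}, G.Adj a b → L b ≤ L a + 1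
  eq_zero : ∀ {a}, L a = 0 ↔ a = x ∨ a = y
  exists_pred : ∀ {a i}, L a = i + 1 → i < 4 → ∃ b, G.Adj a b ∧ L b = i

theorem coe_depth {V : Type*} (G : SimpleGraph V) (x y v : V) :
    (depth G x y v : ℕ∞) = min (min (G.edist v x) (G.edist v y)) 5 :=
  ENat.natCast_toNat (by simp)

theorem depth_eq_iff {V : Type*} (G : SimpleGraph V) (x y v : V) {i : ℕ} (hi : i < 5) :
    depth G x y v = i ↔ v ∈ level G x y i := by
  have hi' : ((i : ℕ) : ℕ∞) < 5 := by exact_mod_cast hi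
  rw [← Nat.cast_inj (R := ℕ∞), coe_depth, level, Set.mem_ofPred_eq]
  constructor
  · intro h
    rcases min_choice (min (G.edist v x) (G.edist v y)) 5 with h' | h'
    · rw [← h, h']
    · rw [h] at h'; exact absurd h' hi'.ne
  · intro h
    rw [h, min_eq_left hi'.le]

theorem SimpleGraph.edist_le_add_one_of_adj {V : Type*} {G : SimpleGraph V} {a b : V}
    (h : G.Adj a b) (z : V) : G.edist b z ≤ G.edist a z + 1 := by
  have h1 : G.edist b a = 1 := SimpleGraph.edist_eq_one_iff_adj.2 h.symm
  calc G.edist b z ≤ G.edist b a + G.edist a z := SimpleGraph.edist_triangle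
    _ = G.edist a z + 1 := by rw [h1, add_comm]

theorem SimpleGraph.exists_adj_edist_le {V : Type*} {G : SimpleGraph V} {a z : V} {i : ℕ}
    (h : G.edist a z = ((i + 1 : ℕ) : ℕ∞)) : ∃ b, G.Adj a b ∧ G.edist b z ≤ i := by
  obtain ⟨p, hp⟩ := SimpleGraph.exists_walk_of_edist_ne_top (G := G) (u := a) (v := z)
    (by rw [h]; exact ENat.natCast_ne_top _)
  rw [h] at hp
  have hp' : p.length = i + 1 := by exact_mod_cast hp
  cases p with
  | nil => simp at hp'
  | cons hab q =>
    refine ⟨_, hab, ?_⟩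
    have : q.length = i := by simpa using hp'
    rw [← this]
    exact SimpleGraph.Walk.edist_le q

theorem isLayering_depth {V : Type*} (G : SimpleGraph V) (x y : V) :
    IsLayering G x y (depth G x y) where
  le_of_adj {a b} h := by
    rw [← Nat.cast_le (α := ℕ∞)]
    push_cast
    rw [coe_depth, coe_depth]
    have h1 := SimpleGraph.edist_le_add_one_of_adj h x
    have h2 := SimpleGraph.edist_le_add_one_of_adj h y
    rcases min_choice (min (G.edist a x) (G.edist a y)) 5 with h' | h'
    · rw [h']
      rcases min_choice (G.edist a x) (G.edist a y) with h' | h'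
      · rw [h']; exact ((min_le_left _ _).trans (min_le_left _ _)).trans h1
      · rw [h']; exact ((min_le_left _ _).trans (min_le_right _ _)).trans h2
    · rw [h']; exact (min_le_right _ _).trans (by simp)
  eq_zero {a} := by
    rw [depth_eq_iff G x y a (by norm_num)]
    simp only [level, Set.mem_ofPred_eq, Nat.cast_zero]
    rw [← nonpos_iff_eq_zero, min_le_iff, nonpos_iff_eq_zero, nonpos_iff_eq_zero,
      SimpleGraph.edist_eq_zero_iff, SimpleGraph.edist_eq_zero_iff]
  exists_pred {a i} h hi := by
    have h' := (depth_eq_iff G x y a (by omega)).1 h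
    have hlev : min (G.edist a x) (G.edist a y) = ((i + 1 : ℕ) : ℕ∞) := h'
    have main : ∃ b, G.Adj a b ∧ min (G.edist b x) (G.edist b y) ≤ i := by
      rcases min_choice (G.edist a x) (G.edist a y) with e | e
      · obtain ⟨b, hb, hb'⟩ := SimpleGraph.exists_adj_edist_le (e.symm.trans hlev)
        exact ⟨b, hb, (min_le_left _ _).trans hb'⟩
      · obtain ⟨b, hb, hb'⟩ := SimpleGraph.exists_adj_edist_le (e.symm.trans hlev)
        exact ⟨b, hb, (min_le_right _ _).trans hb'⟩
    obtain ⟨b, hab, hb⟩ := main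
    refine ⟨b, hab, ?_⟩
    have hle : depth G x y b ≤ i := by
      rw [← Nat.cast_le (α := ℕ∞), coe_depth]
      exact (min_le_left _ _).trans hb
    have hge : i + 1 ≤ depth G x y b + 1 := by
      rw [← h, ← Nat.cast_le (α := ℕ∞)]
      push_cast
      rw [coe_depth, coe_depth]
      have h1 := SimpleGraph.edist_le_add_one_of_adj hab.symm x
      have h2 := SimpleGraph.edist_le_add_one_of_adj hab.symm y
      rcases min_choice (min (G.edist b x) (G.edist b y)) 5 with h' | h'
      · rw [h']
        rcases min_choice (G.edist b x) (G.edist b y) with h' | h'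
        · rw [h']; exact ((min_le_left _ _).trans (min_le_left _ _)).trans h1
        · rw [h']; exact ((min_le_left _ _).trans (min_le_right _ _)).trans h2
      · rw [h']; exact (min_le_right _ _).trans (by simp)
    omega

theorem mem_levelX_iff {V : Type*} (G : SimpleGraph V) (x y v : V) :
    v ∈ levelX G x y ↔ depth G x y v ≤ 3 := by
  have h0 := (isLayering_depth G x y).eq_zero (a := v)
  have h1 := depth_eq_iff G x y v (i := 1) (by norm_num)
  have h2 := depth_eq_iff G x y v (i := 2) (by norm_num)
  have h3 := depth_eq_iff G x y v (i := 3) (by norm_num)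
  simp only [levelX, Set.mem_union, Set.mem_insert_iff, Set.mem_singleton_iff]
  rw [← h0, ← h1, ← h2, ← h3]
  omega

theorem mem_levelY_iff {V : Type*} (G : SimpleGraph V) (x y v : V) :
    v ∈ levelY G x y ↔ 4 ≤ depth G x y v := by
  rw [levelY, Set.mem_compl_iff, mem_levelX_iff]
  omega

/-! ### Colorings of the layers -/

section Layers

variable {V : Type*} (G : SimpleGraph V) (L : V → ℕ)

/-- `u` lies in layer `2` and is isolated there. -/
def IsolatedTwo (u : V) : Prop := L u = 2 ∧ ∀ w, L w = 2 → ¬ G.Adj u w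

/-- `t` lies in layer `3` and `u` is its only neighbor in layer `2`. -/
def Private (u t : V) : Prop := L t = 3 ∧ G.Adj t u ∧ L u = 2 ∧ ∀ w, L w = 2 → G.Adj t w → w = u

/-- `bl` is the set of black vertices of layers `3` and `4` in a feasible coloring. -/
structure IsLayerColoring (bl : V → Prop) : Prop where
  one_indep : ∀ {a b}, L a = 1 → L b = 1 → ¬ G.Adj a b
  exists_owner : ∀ {t}, L t = 3 → bl t → ∃ u, IsolatedTwo G L u ∧ Private G L u t
  bichromatic : ∀ {t z}, L t = 3 → (L z = 3 ∨ L z = 4) → G.Adj t z → (bl t ↔ ¬ bl z)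
  four_edge : ∀ {z z'}, L z = 4 → L z' = 4 → G.Adj z z' → bl z ∨ bl z'
  four_mate : ∀ {z a b}, L z = 4 → L a = 4 → L b = 4 → bl z → bl a → bl b →
    G.Adj z a → G.Adj z b → a = b
  exists_black : ∀ {u}, IsolatedTwo G L u → ∃ t, Private G L u t ∧ bl t
  black_unique : ∀ {u s t}, IsolatedTwo G L u → Private G L u s → Private G L u t →
    bl s → bl t → s = t
  four_neighbor : ∀ {z}, L z = 4 → bl z → ∃ r, G.Adj z r ∧ 4 ≤ L r

/-- A private neighbor of `u` without neighbors in layer `4` and without neighbors in layer `3` other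
than private neighbors of `u`. -/
def InVertex (u t : V) : Prop :=
  Private G L u t ∧ (∀ s, L s = 3 → ¬ Private G L u s → ¬ G.Adj t s) ∧
    ∀ s, L s = 4 → ¬ G.Adj t s

/-- Edges with one end in layer `3` and the other in layer `3` or `4`. -/
def BichromaticEdge (v w : V) : Prop :=
  G.Adj v w ∧ (L v = 3 ∧ (L w = 3 ∨ L w = 4) ∨ L v = 4 ∧ L w = 3)

/-- One round of color propagation, for the color black. -/
def stepBlack (KB KW : V → Prop) (v : V) : Prop :=
  KB v ∨ (∃ w, BichromaticEdge G L v w ∧ KW w) ∨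
  (L v = 4 ∧ ∃ w, L w = 4 ∧ G.Adj v w ∧ KW w) ∨
  (∃ u, IsolatedTwo G L u ∧ Private G L u v ∧ ∀ t, Private G L u t → t ≠ v → KW t) ∨
  (L v = 3 ∧ ∃ z, L z = 4 ∧ G.Adj v z ∧ ∀ r, G.Adj z r → L r ≤ 3)

/-- One round of color propagation, for the color white. -/
def stepWhite (KB KW : V → Prop) (v : V) : Prop :=
  KW v ∨ (∃ w, BichromaticEdge G L v w ∧ KB w) ∨
  (L v = 3 ∧ ∀ u, IsolatedTwo G L u → ¬ Private G L u v) ∨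
  (∃ u, IsolatedTwo G L u ∧ Private G L u v ∧ ∃ t, Private G L u t ∧ t ≠ v ∧ KB t) ∨
  (L v = 3 ∧ ∃ z z', L z = 4 ∧ L z' = 4 ∧ G.Adj z z' ∧ G.Adj v z ∧ G.Adj v z') ∨
  (∃ u, IsolatedTwo G L u ∧ Private G L u v ∧ ∃ s q, Private G L u s ∧ s ≠ v ∧
    (L q = 3 ∨ L q = 4) ∧ G.Adj v q ∧ G.Adj s q)

/-- The colors known after `r` rounds of propagation: black vertices and white vertices. -/
def known (IB IW : V → Prop) : ℕ → (V → Prop) × (V → Prop)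
  | 0 => (IB, IW)
  | r + 1 => (stepBlack G L (known IB IW r).1 (known IB IW r).2,
      stepWhite G L (known IB IW r).1 (known IB IW r).2)

/-- The color of `v` is known after `r` rounds. -/
def Known (IB IW : V → Prop) (r : ℕ) (v : V) : Prop :=
  (known G L IB IW r).1 v ∨ (known G L IB IW r).2 v

variable {G L}

theorem Known.mono {IB IW : V → Prop} {r r' : ℕ} {v : V} (h : Known G L IB IW r v) (hr : r ≤ r') :
    Known G L IB IW r' v := by
  induction r', hr using Nat.le_induction with
  | base => exact h
  | succ k _ ih => exact ih.imp Or.inl Or.inl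

section Sound

variable {bl IB IW : V → Prop} (hc : IsLayerColoring G L bl)
include hc

/-- For the last rule: a vertex $z$ of layer 4 without neighbors in $Y$ cannot be black, as it would
stay isolated, so its neighbors in layer 3 are black. -/
theorem IsLayerColoring.stepBlack_sound {KB KW : V → Prop} (hB : ∀ v, KB v → bl v)
    (hW : ∀ v, KW v → ¬ bl v) {v : V} (h : stepBlack G L KB KW v) : bl v := by
  rcases h with h | ⟨w, ⟨hvw, h | h⟩, hw⟩ | ⟨hv, w, hw, hvw, hk⟩ | ⟨u, hu, hv, h⟩ |
    ⟨hv, z, hz, hvz, h⟩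
  · exact hB v h
  · exact (hc.bichromatic h.1 h.2 hvw).2 (hW w hw)
  · have := hc.bichromatic h.2 (Or.inr h.1) hvw.symm
    have := hW w hw
    tauto
  · exact (hc.four_edge hv hw hvw).resolve_right (hW w hk)
  · obtain ⟨t, ht, hbt⟩ := hc.exists_black hu
    by_contra hb
    exact hW t (h t ht fun e => hb (e ▸ hbt)) hbt
  · by_contra hb
    have hbz : bl z := by
      have := hc.bichromatic hv (Or.inr hz) hvz
      tauto
    obtain ⟨r, hr, hr'⟩ := hc.four_neighbor hz hbz
    have := h r hr
    omega

/-- For the last two rules: a black $v$ would make two adjacent neighbors in layer 4 both white; and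
two vertices of $T_u$ with a common neighbor $q$ both have the color opposite to $q$, which cannot
be black twice in $T_u$. -/
theorem IsLayerColoring.stepWhite_sound {KB KW : V → Prop} (hB : ∀ v, KB v → bl v)
    (hW : ∀ v, KW v → ¬ bl v) {v : V} (h : stepWhite G L KB KW v) : ¬ bl v := by
  rcases h with h | ⟨w, ⟨hvw, h | h⟩, hw⟩ | ⟨hv, h⟩ | ⟨u, hu, hv, t, ht, htv, hk⟩ |
    ⟨hv, z, z', hz, hz', hzz, hvz, hvz'⟩ | ⟨u, hu, hv, s, q, hs, hsv, hq, hvq, hsq⟩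
  · exact hW v h
  · have := hc.bichromatic h.1 h.2 hvw
    have := hB w hw
    tauto
  · exact (hc.bichromatic h.2 (Or.inr h.1) hvw.symm).1 (hB w hw)
  · intro hb
    obtain ⟨u, hu, hu'⟩ := hc.exists_owner hv hb
    exact h u hu hu'
  · exact fun hb => htv (hc.black_unique hu ht hv (hB t hk) hb)
  · have h1 := hc.bichromatic hv (Or.inr hz) hvz
    have h2 := hc.bichromatic hv (Or.inr hz') hvz'
    have h3 := hc.four_edge hz hz' hzz
    tauto
  · intro hb
    have h1 := hc.bichromatic hv.1 hq hvq
    have h2 := hc.bichromatic hs.1 hq hsq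
    exact hsv (hc.black_unique hu hs hv (by tauto) hb)

theorem IsLayerColoring.known_sound (hB : ∀ v, IB v → bl v) (hW : ∀ v, IW v → ¬ bl v) (r : ℕ) :
    (∀ v, (known G L IB IW r).1 v → bl v) ∧ ∀ v, (known G L IB IW r).2 v → ¬ bl v := by
  induction r with
  | zero => exact ⟨hB, hW⟩
  | succ r ih =>
    exact ⟨fun v => hc.stepBlack_sound ih.1 ih.2, fun v => hc.stepWhite_sound ih.1 ih.2⟩

end Sound

/-- The initial colors `IB`, `IW` are correct. -/
structure IsSound (bl IB IW : V → Prop) : Prop where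
  black : ∀ v, IB v → bl v
  white : ∀ v, IW v → ¬ bl v

section Complete

variable {bl IB IW : V → Prop} (hc : IsLayerColoring G L bl) (hI : IsSound bl IB IW)
include hc hI

theorem IsLayerColoring.known_black {r : ℕ} {v : V} (h : Known G L IB IW r v) (hb : bl v) :
    (known G L IB IW r).1 v :=
  h.resolve_right fun h' => (hc.known_sound hI.black hI.white r).2 v h' hb

theorem IsLayerColoring.known_white {r : ℕ} {v : V} (h : Known G L IB IW r v) (hb : ¬ bl v) :
    (known G L IB IW r).2 v :=
  h.resolve_left fun h' => hb ((hc.known_sound hI.black hI.white r).1 v h')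

omit hc hI in
theorem known_of_edge {r : ℕ} {v w : V} (h : Known G L IB IW r w)
    (he : BichromaticEdge G L v w) : Known G L IB IW (r + 1) v :=
  h.elim (fun h => Or.inr (Or.inr (Or.inl ⟨w, he, h⟩)))
    fun h => Or.inl (Or.inr (Or.inl ⟨w, he, h⟩))

/-- The true coloring tells which rule fires: if $v$ is black, all others are known to be white; if
$v$ is white, one of the others is known to be black. -/
theorem IsLayerColoring.known_of_others {r : ℕ} {u v : V} (hu : IsolatedTwo G L u)
    (hv : Private G L u v) (h : ∀ t, Private G L u t → t ≠ v → Known G L IB IW r t) :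
    Known G L IB IW (r + 1) v := by
  by_cases hb : bl v
  · refine Or.inl (Or.inr (Or.inr (Or.inr (Or.inl ⟨u, hu, hv, fun t ht htv => ?_⟩))))
    exact hc.known_white hI (h t ht htv) fun hbt => htv (hc.black_unique hu ht hv hbt hb)
  · obtain ⟨t, ht, hbt⟩ := hc.exists_black hu
    have htv : t ≠ v := fun e => hb (e ▸ hbt)
    exact Or.inr (Or.inr (Or.inr (Or.inr (Or.inl
      ⟨u, hu, hv, t, ht, htv, hc.known_black hI (h t ht htv) hbt⟩))))

theorem IsLayerColoring.known_of_black {r : ℕ} {u b v : V} (hu : IsolatedTwo G L u)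
    (hb : Private G L u b) (hbb : bl b) (hv : Private G L u v) (h : Known G L IB IW r b) :
    Known G L IB IW (r + 1) v := by
  by_cases hbv : b = v
  · exact hbv ▸ h.mono (Nat.le_succ r)
  · exact Or.inr (Or.inr (Or.inr (Or.inr (Or.inl ⟨u, hu, hv, b, hb, hbv,
      hc.known_black hI h hbb⟩))))

omit hc hI in
theorem known_of_no_owner {v : V} (hv : L v = 3)
    (h : ∀ u, IsolatedTwo G L u → ¬ Private G L u v) : Known G L IB IW 1 v :=
  Or.inr (Or.inr (Or.inr (Or.inl ⟨hv, h⟩)))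

omit hc hI in
theorem known_of_common_neighbor {u v s q : V} (hu : IsolatedTwo G L u) (hv : Private G L u v)
    (hs : Private G L u s) (hsv : s ≠ v) (hq : L q = 3 ∨ L q = 4) (hvq : G.Adj v q)
    (hsq : G.Adj s q) : Known G L IB IW 1 v :=
  Or.inr (Or.inr (Or.inr (Or.inr (Or.inr (Or.inr ⟨u, hu, hv, s, q, hs, hsv, hq, hvq, hsq⟩)))))

/-- If all private neighbors of `u` other than in-vertices are known, the remaining ones follow. -/
theorem IsLayerColoring.known_of_not_inVertex {r : ℕ} {u : V} (hu : IsolatedTwo G L u)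
    (hin : ∀ s t, InVertex G L u s → InVertex G L u t → s = t)
    (h : ∀ t z, Private G L u t → G.Adj t z → (L z = 4 ∨ L z = 3 ∧ ¬ Private G L u z) →
      Known G L IB IW r t) {t : V} (ht : Private G L u t) : Known G L IB IW (r + 1) t := by
  have h' : ∀ t, Private G L u t → ¬ InVertex G L u t → Known G L IB IW r t := by
    intro t ht hti
    by_contra hk
    exact hti ⟨ht, fun s hs hus hts => hk (h t s ht hts (Or.inr ⟨hs, hus⟩)),
      fun s hs hts => hk (h t s ht hts (Or.inl hs))⟩
  -- If $t$ is the in-vertex, all other vertices of $T_u$ are already known, and $t$ follows one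
  -- round later.
  by_cases hti : InVertex G L u t
  · exact hc.known_of_others hI hu ht fun s hs hst =>
      h' s hs fun hsi => hst (hin s t hsi hti)
  · exact (h' t ht hti).mono (Nat.le_succ r)

end Complete

end Layers

/-! ### Forks -/

section Forks

variable {V : Type*} {G : SimpleGraph V} {x y : V} {L : V → ℕ}

theorem IsLayering.not_adj (hL : IsLayering G x y L) {a b : V} (h : L a + 1 < L b) :
    ¬ G.Adj a b := fun hab => by
  have := hL.le_of_adj hab
  omega

theorem IsLayering.not_adj' (hL : IsLayering G x y L) {a b : V} (h : L b + 1 < L a) :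
    ¬ G.Adj a b := fun hab => hL.not_adj h hab.symm

theorem IsLayering.exists_adj_zero (hL : IsLayering G x y L) {w : V} (hw : L w = 1) :
    G.Adj w x ∨ G.Adj w y := by
  obtain ⟨a, ha, h0⟩ := hL.exists_pred hw (by norm_num)
  rcases hL.eq_zero.1 h0 with rfl | rfl
  exacts [Or.inl ha, Or.inr ha]

theorem IsLayering.exists_adj_one (hL : IsLayering G x y L) {u : V} (hu : L u = 2) :
    ∃ w, L w = 1 ∧ G.Adj w u := by
  obtain ⟨a, ha, h0⟩ := hL.exists_pred hu (by norm_num)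
  exact ⟨a, h0, ha.symm⟩

variable (G L) in
/-- `z` has depth at least `4`, or it is a private neighbor of a vertex isolated in layer `2`. -/
def Owned (z : V) : Prop := 4 ≤ L z ∨ ∃ v, IsolatedTwo G L v ∧ Private G L v z

theorem Owned.three_le {z : V} (h : Owned G L z) : 3 ≤ L z := by
  rcases h with h | ⟨v, _, h⟩
  · omega
  · exact h.1.ge

/-- Depth at least 4 excludes neighbors in layer 2, and a private neighbor has only one. So an owned
vertex meets at most one vertex of layer 2, which can be served by a single seed. -/
theorem Owned.private_of_adj (hL : IsLayering G x y L) {z u : V} (h : Owned G L z)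
    (hu : L u = 2) (hzu : G.Adj z u) : Private G L u z := by
  rcases h with h | ⟨v, _, h⟩
  · exact absurd hzu (hL.not_adj' (by omega))
  · rw [h.2.2.2 u hu hzu]; exact h

variable (G L) in
/-- Two nonadjacent private neighbors `s`, `s'` of `v`, distinguished by a vertex `q`. -/
structure Fork (v s s' q : V) : Prop where
  isolated : IsolatedTwo G L v
  left : Private G L v s
  right : Private G L v s'
  not_adj : ¬ G.Adj s s'
  adj : G.Adj s' q
  not_adj_left : ¬ G.Adj s q
  owned : Owned G L q
  not_adj_root : ¬ G.Adj v q

theorem Private.not_adj {v s u : V} (h : Private G L v s) (hu : L u = 2) (huv : u ≠ v) :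
    ¬ G.Adj s u := fun h' => huv (h.2.2.2 u hu h')

variable (hG : IsSpider124Free G) (hL : IsLayering G x y L)
  (hone : ∀ {a b}, L a = 1 → L b = 1 → ¬ G.Adj a b)
include hG hL hone

/-- Otherwise neighbors $w$ of $v$ and $w'$ of $u$ in layer 1 give a spider with center $v$ and legs
$s$ and $s',q$. The long leg is $w,a,w',u$ if some $a\in\{x,y\}$ is adjacent to both $w$ and $w'$,
and $w,a,b,w'$ with $\{a,b\}=\{x,y\}$ if not. -/
theorem Fork.exists_common_neighbor (hxy : G.Adj x y) {v s s' q : V} (hF : Fork G L v s s' q)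
    {u : V} (hu : IsolatedTwo G L u) (huv : u ≠ v) (huq : ¬ G.Adj u q) :
    ∃ w, L w = 1 ∧ G.Adj w u ∧ G.Adj w v := by
  by_contra! hno
  obtain ⟨hv, hs, hs', hss, hadj, hsq, hq, hvq⟩ := hF
  have hq3 := hq.three_le
  have hv2 := hv.1
  have hu2 := hu.1
  have hs3 := hs.1
  have hs3' := hs'.1
  have hvs := hs.2.1.symm
  have hvs' := hs'.2.1.symm
  have hsu := hs.not_adj hu2 huv
  have hsu' := hs'.not_adj hu2 huv
  have hvu := hv.2 u hu2
  have hqu : ¬ G.Adj q u := fun h => huq h.symm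
  obtain ⟨w, hw, hwv⟩ := hL.exists_adj_one hv2
  obtain ⟨w', hw', hwu'⟩ := hL.exists_adj_one hu2
  have hwu : ¬ G.Adj w u := fun h => hno w hw h hwv
  have hvw' : ¬ G.Adj v w' := fun h => hno w' hw' hwu' h.symm
  have hww := hone hw hw'
  have hvw := hwv.symm
  have short : ∀ a, L a = 0 → G.Adj w a → G.Adj w' a → False := by
    intro a ha hwa hwa'
    have haw' := hwa'.symm
    apply hG.false_of_spider (c := v) (a := s) (b₁ := s') (b₂ := q) (d₁ := w) (d₂ := a) (d₃ := w')
      (d₄ := u)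
    all_goals first | assumption | (apply hL.not_adj; omega) | (apply hL.not_adj'; omega)
  have long : ∀ a b, L a = 0 → L b = 0 → G.Adj a b → G.Adj w a → G.Adj w' b →
      ¬ G.Adj w b → ¬ G.Adj w' a → False := by
    intro a b ha hb hab hwa hwb' hwb hwa'
    have hbw' := hwb'.symm
    have haw' : ¬ G.Adj a w' := fun h => hwa' h.symm
    apply hG.false_of_spider (c := v) (a := s) (b₁ := s') (b₂ := q) (d₁ := w) (d₂ := a) (d₃ := b)
      (d₄ := w')
    all_goals first | assumption | (apply hL.not_adj; omega) | (apply hL.not_adj'; omega)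
  have hx : L x = 0 := hL.eq_zero.2 (Or.inl rfl)
  have hy : L y = 0 := hL.eq_zero.2 (Or.inr rfl)
  have h1 := hL.exists_adj_zero hw
  have h2 := hL.exists_adj_zero hw'
  have h3 := short x hx
  have h4 := short y hy
  have h5 := long x y hx hy hxy
  have h6 := long y x hy hx hxy.symm
  tauto

omit hone in
-- The spider has center $v$ and legs $s$; $s',q$; $w,u,t,r$.
theorem Fork.false_of_path {v s s' q : V} (hF : Fork G L v s s' q) {w u t r : V}
    (hw : L w = 1) (hwv : G.Adj w v) (hwu : G.Adj w u) (hu : IsolatedTwo G L u) (huv : u ≠ v)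
    (ht : Private G L u t) (hr : 3 ≤ L r) (htr : G.Adj t r) (hur : ¬ G.Adj u r)
    (hvr : ¬ G.Adj v r) (huq : ¬ G.Adj u q) (hst : ¬ G.Adj t s) (hst' : ¬ G.Adj t s')
    (htq : ¬ G.Adj t q) (hsr : ¬ G.Adj r s) (hsr' : ¬ G.Adj r s') (hqr : ¬ G.Adj r q) : False := by
  obtain ⟨hv, hs, hs', hss, hadj, hsq, hq, hvq⟩ := hF
  have hq3 := hq.three_le
  have hv2 := hv.1
  have hu2 := hu.1
  have hs3 := hs.1
  have hs3' := hs'.1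
  have ht3 := ht.1
  have hvs := hs.2.1.symm
  have hvs' := hs'.2.1.symm
  have hsu := hs.not_adj hu2 huv
  have hsu' := hs'.not_adj hu2 huv
  have hvu := hv.2 u hu2
  have hvt : ¬ G.Adj v t := fun h => ht.not_adj hv2 huv.symm h.symm
  have hut := ht.2.1.symm
  rw [G.adj_comm] at huq hst hst' htq hsr hsr' hqr
  have hvw := hwv.symm
  apply hG.false_of_spider (c := v) (a := s) (b₁ := s') (b₂ := q) (d₁ := w) (d₂ := u) (d₃ := t)
    (d₄ := r)
  all_goals first | assumption | (apply hL.not_adj; omega) | (apply hL.not_adj'; omega)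

end Forks

section ForkComplete

variable {V : Type*} {G : SimpleGraph V} {x y : V} {L : V → ℕ} {bl IB IW : V → Prop}

/-- With a fork, every color follows from those of a bounded number of vertices. -/
theorem Fork.known (hG : IsSpider124Free G) (hL : IsLayering G x y L) (hxy : G.Adj x y)
    (hc : IsLayerColoring G L bl) (hI : IsSound bl IB IW)
    (hin : ∀ u, IsolatedTwo G L u → ∀ s t, InVertex G L u s → InVertex G L u t → s = t)
    {v s s' q p b : V} (hF : Fork G L v s s' q)
    (hs : Known G L IB IW 0 s) (hs' : Known G L IB IW 0 s') (hq : Known G L IB IW 0 q)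
    (hb : Private G L v b) (hbb : bl b) (hkb : Known G L IB IW 0 b)
    (howner : ∀ u, IsolatedTwo G L u → G.Adj u q →
      ∃ t, Private G L u t ∧ bl t ∧ Known G L IB IW 0 t)
    (hmate : ∀ z, L z = 4 → L q = 4 → bl q → G.Adj q z → z ≠ p → Known G L IB IW 0 z)
    (hp : Known G L IB IW 0 p)
    {u t : V} (hu : IsolatedTwo G L u) (ht : Private G L u t) : Known G L IB IW 3 t := by
  have hTv : ∀ r, Private G L v r → Known G L IB IW 1 r := fun r hr =>
    hc.known_of_black hI hF.isolated hb hbb hr hkb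
  by_cases huv : u = v
  · subst huv
    exact (hTv t ht).mono (by norm_num)
  by_cases huq : G.Adj u q
  · obtain ⟨t', ht', hbt', hk⟩ := howner u hu huq
    exact (hc.known_of_black hI hu ht' hbt' ht hk).mono (by norm_num)
  obtain ⟨w, hw, hwu, hwv⟩ := hF.exists_common_neighbor hG hL hc.one_indep hxy hu huv huq
  refine hc.known_of_not_inVertex hI hu (hin u hu) (r := 2) ?_ ht
  clear ht t
  intro t r ht htr hr
  have ht3 := ht.1
  have he : BichromaticEdge G L t r := ⟨htr, Or.inl ⟨ht.1, by tauto⟩⟩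
  have hq34 : L q = 3 ∨ L q = 4 := by
    have h1 := hL.le_of_adj hF.adj
    have h2 := hF.owned.three_le
    have := hF.right.1
    omega
  by_cases hr1 : Known G L IB IW 1 r
  · exact known_of_edge hr1 he
  -- A vertex of layer 3 without an owner is white by a rule that needs no seeds.
  have hown : Owned G L r := by
    by_contra hown
    have hr3 : L r = 3 := by
      by_contra h3
      exact hown (Or.inl (by omega))
    exact hr1 (known_of_no_owner hr3 fun u' hu' h => hown (Or.inr ⟨u', hu', h⟩))
  have hvr : ¬ G.Adj v r := fun h => hr1 (hTv r (hown.private_of_adj hL hF.isolated.1 h.symm))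
  have hur : ¬ G.Adj u r := fun h => by
    have := hown.private_of_adj hL hu.1 h.symm
    have := this.1
    rcases hr with hr | hr
    · omega
    · tauto
  have hs3 := hF.left.1
  have hs3' := hF.right.1
  have known_t : ∀ z, (L z = 3 ∨ L z = 4) → Known G L IB IW 0 z → G.Adj t z →
      Known G L IB IW 2 t := fun z hz hk htz =>
    (known_of_edge hk ⟨htz, Or.inl ⟨ht3, hz⟩⟩).mono (by norm_num)
  have known_r : ∀ z, L z = 3 → Known G L IB IW 0 z → G.Adj r z → False := fun z hz hk hrz =>
    hr1 (known_of_edge hk ⟨hrz, by omega⟩)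
  by_contra hk
  refine hF.false_of_path hG hL hw hwv hwu hu huv ht hown.three_le htr hur hvr huq
    (fun h => hk (known_t s (Or.inl hs3) hs h)) (fun h => hk (known_t s' (Or.inl hs3') hs' h))
    (fun h => hk (known_t q hq34 hq h)) (known_r s hs3 hs) (known_r s' hs3' hs') fun hrq => ?_
  rcases hq34 with hq3 | hq4
  · exact known_r q hq3 hq hrq
  -- An edge $rq$ inside layer 4 need not be bichromatic. If $q$ is white, $r$ is black; if $q$ is
  -- black, $r$ is either the seed $p$ or one of the neighbors of $q$ known through `hmate`.
  rcases hr with hr4 | hr3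
  · by_cases hbq : bl q
    · by_cases hrp : r = p
      · exact hr1 (hrp ▸ hp.mono (by norm_num))
      · exact hr1 ((hmate r hr4 hq4 hbq hrq.symm hrp).mono (by norm_num))
    · exact hr1 (Or.inl (Or.inr (Or.inr (Or.inl ⟨hr4, q, hq4, hrq, hc.known_white hI hq hbq⟩))))
  · exact hr1 (known_of_edge hq ⟨hrq, by omega⟩)

end ForkComplete

/-! ### Tails -/

section Tails

variable {V : Type*} {G : SimpleGraph V} {x y : V} {L : V → ℕ}

variable (G L) in
/-- An induced path `u, t, q, r` leading from a vertex isolated in layer `2` to deeper layers. -/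
structure Tail (u t q r : V) : Prop where
  isolated : IsolatedTwo G L u
  first : Private G L u t
  adj₁ : G.Adj t q
  adj₂ : G.Adj q r
  not_adj₁ : ¬ G.Adj u q
  not_adj₂ : ¬ G.Adj u r
  not_adj₃ : ¬ G.Adj t r
  owned₁ : Owned G L q
  owned₂ : Owned G L r

variable (G L) in
/-- The tail `u, t, q, r` touches `u'`, or `u` and `u'` have a common neighbor in layer `1`. -/
def Covers (u q r u' : V) : Prop :=
  u' = u ∨ G.Adj q u' ∨ G.Adj r u' ∨ ∃ w, L w = 1 ∧ G.Adj w u ∧ G.Adj w u'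

/-- The spider has center $w$ and legs $a$; $u',s$; $u,t,q,r$, where $a\in\{x,y\}$. Hence $s$ is
adjacent to $t$, $q$ or $r$, and its color follows along that edge. -/
theorem Tail.false_of_private (hG : IsSpider124Free G) (hL : IsLayering G x y L)
    {u t q r : V} (hT : Tail G L u t q r) {u' s w : V} (hw : L w = 1) (hwu : G.Adj w u)
    (hwu' : G.Adj w u') (huu : u' ≠ u) (hu' : IsolatedTwo G L u') (hs : Private G L u' s)
    (hqu : ¬ G.Adj q u') (hru : ¬ G.Adj r u') (hst : ¬ G.Adj s t) (hsq : ¬ G.Adj s q)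
    (hsr : ¬ G.Adj s r) : False := by
  obtain ⟨hu, ht, htq, hqr, huq, hur, htr, hoq, hor⟩ := hT
  have hq3 := hoq.three_le
  have hr3 := hor.three_le
  have hu2 := hu.1
  have hu2' := hu'.1
  have hs3 := hs.1
  have ht3 := ht.1
  have hsu := hs.not_adj hu2 huu.symm
  have hut' : ¬ G.Adj u' t := fun h => ht.not_adj hu2' huu h.symm
  have huu' := hu'.2 u hu2
  have hut := ht.2.1.symm
  have hsu' := hs.2.1.symm
  rw [G.adj_comm] at hqu hru
  obtain ⟨a, hwa, ha⟩ := hL.exists_pred hw (by norm_num)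
  apply hG.false_of_spider (c := w) (a := a) (b₁ := u') (b₂ := s) (d₁ := u) (d₂ := t) (d₃ := q)
    (d₄ := r)
  all_goals first | assumption | (apply hL.not_adj; omega)

/-- The spider has center $a$ and legs $w_3$; $w_2,u_2$; $w,u,t,q$. The vertex $u_3$ is not part of
it; it only certifies that $w_3$ is adjacent to neither $u$ nor $u_2$. -/
theorem Tail.false_of_uncovered (hG : IsSpider124Free G) (hL : IsLayering G x y L)
    (hone : ∀ {a b}, L a = 1 → L b = 1 → ¬ G.Adj a b)
    {u t q r : V} (hT : Tail G L u t q r) {u₂ q₂ r₂ u₃ w w₂ w₃ a : V}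
    (hw : L w = 1) (hw₂ : L w₂ = 1) (hw₃ : L w₃ = 1) (ha : L a = 0) (haw : G.Adj a w)
    (haw₂ : G.Adj a w₂) (haw₃ : G.Adj a w₃) (hwu : G.Adj w u) (hwu₂ : G.Adj w₂ u₂)
    (hwu₃ : G.Adj w₃ u₃) (hu₂ : IsolatedTwo G L u₂) (hu₃ : IsolatedTwo G L u₃)
    (h₁₂ : ¬ Covers G L u q r u₂) (h₁₃ : ¬ Covers G L u q r u₃)
    (h₂₃ : ¬ Covers G L u₂ q₂ r₂ u₃) : False := by
  obtain ⟨hu, ht, htq, hqr, huq, hur, htr, hoq, hor⟩ := hT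
  have hq3 := hoq.three_le
  have h2 := hu.1
  have h2₂ := hu₂.1
  have h2₃ := hu₃.1
  have ht3 := ht.1
  have hwt := ht.2.1.symm
  have n1 : ¬ G.Adj w₃ u₂ := fun h => h₂₃ (Or.inr (Or.inr (Or.inr ⟨w₃, hw₃, h, hwu₃⟩)))
  have n2 : ¬ G.Adj w₃ u := fun h => h₁₃ (Or.inr (Or.inr (Or.inr ⟨w₃, hw₃, h, hwu₃⟩)))
  have n3 : ¬ G.Adj w₂ u := fun h => h₁₂ (Or.inr (Or.inr (Or.inr ⟨w₂, hw₂, h, hwu₂⟩)))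
  have n4 : ¬ G.Adj u₂ w := fun h => h₁₂ (Or.inr (Or.inr (Or.inr ⟨w, hw, hwu, h.symm⟩)))
  have n5 : ¬ G.Adj u₂ u := hu₂.2 u h2
  have n6 : ¬ G.Adj u₂ t := fun h => ht.not_adj h2₂ (fun e => h₁₂ (Or.inl e)) h.symm
  have n7 : ¬ G.Adj u₂ q := fun h => h₁₂ (Or.inr (Or.inl h.symm))
  have n8 := hone hw₃ hw₂
  have n9 := hone hw₃ hw
  have n10 := hone hw₂ hw
  apply hG.false_of_spider (c := a) (a := w₃) (b₁ := w₂) (b₂ := u₂) (d₁ := w) (d₂ := u) (d₃ := t)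
    (d₄ := q)
  all_goals first | assumption | (apply hL.not_adj; omega)

variable {bl : V → Prop}

/-- The private neighbors of all vertices covered by a tail become known in one round, from the
colors of six vertices. -/
theorem Tail.exists_list (hG : IsSpider124Free G) (hL : IsLayering G x y L)
    (hc : IsLayerColoring G L bl) {u t q r : V} (hT : Tail G L u t q r) :
    ∃ l : List V, l.length ≤ 6 ∧ ∀ IB IW, IsSound bl IB IW →
      (∀ v ∈ l, Known G L IB IW 0 v) → ∀ u', IsolatedTwo G L u' → Covers G L u q r u' →
      ∀ s, Private G L u' s → Known G L IB IW 1 s := by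
  have hblack : ∀ u, ∃ b, IsolatedTwo G L u → Private G L u b ∧ bl b := fun u => by
    by_cases hu : IsolatedTwo G L u
    · obtain ⟨b, hb⟩ := hc.exists_black hu
      exact ⟨b, fun _ => hb⟩
    · exact ⟨u, fun h => absurd h hu⟩
  choose bk hbk using hblack
  -- The vertex $o$ is the only candidate for an isolated neighbor of $z$ in layer 2; at depth at
  -- least 4 there is none, and the value is arbitrary.
  have hown : ∀ z, Owned G L z → ∃ o, ∀ u, IsolatedTwo G L u → G.Adj z u → u = o := by
    rintro z (hz | ⟨v, hv, hvz⟩)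
    · exact ⟨z, fun u hu hzu => absurd hzu (hL.not_adj' (by have := hu.1; omega))⟩
    · exact ⟨v, fun u hu hzu => hvz.2.2.2 u hu.1 hzu⟩
  obtain ⟨oq, hoq⟩ := hown q hT.owned₁
  obtain ⟨or, hor⟩ := hown r hT.owned₂
  -- The black private neighbors serve the cases $u'=u$, $q\sim u'$ and $r\sim u'$ of `Covers`;
  -- $t,q,r$ serve the case of a common neighbor in layer 1.
  refine ⟨[t, q, r, bk u, bk oq, bk or], by simp, fun IB IW hI hl u' hu' hcov s hs => ?_⟩
  have known_bk : Known G L IB IW 0 (bk u') → Known G L IB IW 1 s := fun h =>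
    hc.known_of_black hI hu' (hbk u' hu').1 (hbk u' hu').2 hs h
  by_cases huu : u' = u
  · exact known_bk (hl _ (by simp [huu]))
  by_cases hqu : G.Adj q u'
  · exact known_bk (hl _ (by simp [hoq u' hu' hqu]))
  by_cases hru : G.Adj r u'
  · exact known_bk (hl _ (by simp [hor u' hu' hru]))
  obtain ⟨w, hw, hwu, hwu'⟩ := ((hcov.resolve_left huu).resolve_left hqu).resolve_left hru
  have edge : ∀ z ∈ [t, q, r, bk u, bk oq, bk or], 3 ≤ L z → G.Adj s z → Known G L IB IW 1 s := by
    intro z hz hz3 hsz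
    have h1 := hL.le_of_adj hsz
    have h2 := hs.1
    exact known_of_edge (hl z hz) ⟨hsz, Or.inl ⟨h2, by omega⟩⟩
  by_contra hk
  exact hT.false_of_private hG hL hw hwu hwu' huu hu' hs hqu hru
    (fun h => hk (edge t (by simp) hT.first.1.ge h))
    (fun h => hk (edge q (by simp) hT.owned₁.three_le h))
    (fun h => hk (edge r (by simp) hT.owned₂.three_le h))

/-- Without forks, the colors at a vertex without tails follow from no assumption. -/
theorem IsLayerColoring.known_of_no_tail (hL : IsLayering G x y L) (hc : IsLayerColoring G L bl)
    (hin : ∀ u, IsolatedTwo G L u → ∀ s t, InVertex G L u s → InVertex G L u t → s = t)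
    (hF : ∀ v s s' q, ¬ Fork G L v s s' q) {u : V} (hu : IsolatedTwo G L u)
    (hT : ∀ t q r, ¬ Tail G L u t q r) {IB IW : V → Prop} (hI : IsSound bl IB IW) {t : V}
    (ht : Private G L u t) : Known G L IB IW 3 t := by
  refine hc.known_of_not_inVertex hI hu (hin u hu) (r := 2) ?_ ht
  clear ht t
  intro t q ht htq hq
  have he : BichromaticEdge G L t q := ⟨htq, Or.inl ⟨ht.1, by tauto⟩⟩
  have hu2 := hu.1
  have ht3 := ht.1
  rcases hq with hq4 | ⟨hq3, hqu⟩
  -- With $q$ in layer 4: if $q$ has no neighbor in $Y$, then $t$ is black; a neighbor $r$ in $Y$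
  -- either is adjacent to $t$, which makes $t$ white, or completes a tail.
  · by_cases hr : ∃ r, G.Adj q r ∧ 4 ≤ L r
    · obtain ⟨r, hqr, hr4⟩ := hr
      by_cases htr : G.Adj t r
      · have h1 := hL.le_of_adj htr
        exact Known.mono (r := 1) (Or.inr (Or.inr (Or.inr (Or.inr (Or.inr (Or.inl
          ⟨ht.1, q, r, hq4, by omega, hqr, htq, htr⟩)))))) (by norm_num)
      · exact absurd ⟨hu, ht, htq, hqr, hL.not_adj (by omega), hL.not_adj (by omega), htr,
          Or.inl hq4.ge, Or.inl hr4⟩ (hT t q r)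
    · push Not at hr
      exact Known.mono (r := 1) (Or.inl (Or.inr (Or.inr (Or.inr (Or.inr
        ⟨ht.1, q, hq4, htq, fun r hqr => by have := hr r hqr; omega⟩))))) (by norm_num)
  · refine known_of_edge ?_ he
    by_cases hown : ∃ v, IsolatedTwo G L v ∧ Private G L v q
    · obtain ⟨v, hv, hvq⟩ := hown
      have huv : u ≠ v := fun e => hqu (e ▸ hvq)
      by_contra hk
      -- If $q$ were alone in $T_v$, it would be known. A second vertex $q'$ is not adjacent to $t$
      -- (common-neighbor rule), so it gives the tail $u,t,q,q'$ if $q\sim q'$, and the fork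
      -- $v,q',q,t$ if not.
      have hothers : ∃ q', Private G L v q' ∧ q' ≠ q := by
        by_contra! hno
        exact hk (hc.known_of_others hI hv hvq fun t ht htq => absurd (hno t ht) htq)
      obtain ⟨q', hvq', hqq⟩ := hothers
      have hq't : ¬ G.Adj q' t := fun h =>
        hk (known_of_common_neighbor hv hvq hvq' hqq (Or.inl ht.1) htq.symm h)
      have hvt : ¬ G.Adj v t := fun h => ht.not_adj hv.1 huv.symm h.symm
      by_cases hadj : G.Adj q q'
      · exact hT t q q' ⟨hu, ht, htq, hadj, fun h => hvq.not_adj hu2 huv h.symm,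
          fun h => hvq'.not_adj hu2 huv h.symm, fun h => hq't h.symm, Or.inr ⟨v, hv, hvq⟩,
          Or.inr ⟨v, hv, hvq'⟩⟩
      · exact hF v q' q t ⟨hv, hvq', hvq, fun h => hadj h.symm, htq.symm, hq't,
          Or.inr ⟨u, hu, ht⟩, hvt⟩
    · exact known_of_no_owner hq3 fun v hv hvq => hown ⟨v, hv, hvq⟩

/-- Without forks, the colors at all vertices isolated in layer `2` that are at distance two from
`a` follow from those of twelve vertices. -/
theorem IsLayerColoring.exists_list_of_no_fork (hG : IsSpider124Free G) (hL : IsLayering G x y L)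
    (hc : IsLayerColoring G L bl)
    (hin : ∀ u, IsolatedTwo G L u → ∀ s t, InVertex G L u s → InVertex G L u t → s = t)
    (hF : ∀ v s s' q, ¬ Fork G L v s s' q) {a : V} (ha : L a = 0) :
    ∃ l : List V, l.length ≤ 12 ∧ ∀ IB IW, IsSound bl IB IW →
      (∀ v ∈ l, Known G L IB IW 0 v) → ∀ u w, IsolatedTwo G L u → L w = 1 → G.Adj a w →
      G.Adj w u → ∀ t, Private G L u t → Known G L IB IW 3 t := by
  by_cases h1 : ∃ u t q r w, Tail G L u t q r ∧ L w = 1 ∧ G.Adj a w ∧ G.Adj w u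
  · obtain ⟨u₁, t₁, q₁, r₁, w₁, hT₁, hw₁, haw₁, hwu₁⟩ := h1
    obtain ⟨l₁, hl₁, hk₁⟩ := hT₁.exists_list hG hL hc
    -- The second tail starts outside the reach of the first. A vertex reached through $a$ but
    -- covered by neither is impossible, whether or not it has a tail.
    by_cases h2 : ∃ u t q r w, Tail G L u t q r ∧ L w = 1 ∧ G.Adj a w ∧ G.Adj w u ∧
        ¬ Covers G L u₁ q₁ r₁ u
    · obtain ⟨u₂, t₂, q₂, r₂, w₂, hT₂, hw₂, haw₂, hwu₂, hcov⟩ := h2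
      obtain ⟨l₂, hl₂, hk₂⟩ := hT₂.exists_list hG hL hc
      refine ⟨l₁ ++ l₂, by simp; omega, fun IB IW hI hl u w hu hw haw hwu t ht => ?_⟩
      by_cases c₁ : Covers G L u₁ q₁ r₁ u
      · exact (hk₁ IB IW hI (fun v hv => hl v (by simp [hv])) u hu c₁ t ht).mono (by norm_num)
      by_cases c₂ : Covers G L u₂ q₂ r₂ u
      · exact (hk₂ IB IW hI (fun v hv => hl v (by simp [hv])) u hu c₂ t ht).mono (by norm_num)
      exact (hT₁.false_of_uncovered hG hL hc.one_indep hw₁ hw₂ hw ha haw₁ haw₂ haw hwu₁ hwu₂ hwu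
        hT₂.isolated hu hcov c₁ c₂).elim
    · refine ⟨l₁, by omega, fun IB IW hI hl u w hu hw haw hwu t ht => ?_⟩
      by_cases c₁ : Covers G L u₁ q₁ r₁ u
      · exact (hk₁ IB IW hI hl u hu c₁ t ht).mono (by norm_num)
      · exact hc.known_of_no_tail hL hin hF hu
          (fun t q r hT => h2 ⟨u, t, q, r, w, hT, hw, haw, hwu, c₁⟩) hI ht
  · refine ⟨[], by simp, fun IB IW hI hl u w hu hw haw hwu t ht => ?_⟩
    exact hc.known_of_no_tail hL hin hF hu
      (fun t q r hT => h1 ⟨u, t, q, r, w, hT, hw, haw, hwu⟩) hI ht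

/-- All colors of layer `3` follow from those of `24` vertices and the choice of a pair `q, p` such
that all neighbors of `q` in layer `4` other than `p` are white. -/
theorem IsLayerColoring.exists_seeds (hG : IsSpider124Free G) (hL : IsLayering G x y L)
    (hxy : G.Adj x y) (hc : IsLayerColoring G L bl)
    (hin : ∀ u, IsolatedTwo G L u → ∀ s t, InVertex G L u s → InVertex G L u t → s = t) :
    ∃ (l : List V) (q p : V), l.length ≤ 24 ∧ (∀ z, L z = 4 → G.Adj q z → z ≠ p → ¬ bl z) ∧
      ∀ IB IW, IsSound bl IB IW → (∀ v ∈ l, Known G L IB IW 0 v) →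
      (∀ z, L z = 4 → G.Adj q z → z ≠ p → Known G L IB IW 0 z) →
      ∀ t, L t = 3 → Known G L IB IW 3 t := by
  have hx : L x = 0 := hL.eq_zero.2 (Or.inl rfl)
  have hy : L y = 0 := hL.eq_zero.2 (Or.inr rfl)
  have reduce : ∀ IB IW, (∀ u, IsolatedTwo G L u → ∀ t, Private G L u t → Known G L IB IW 3 t) →
      ∀ t, L t = 3 → Known G L IB IW 3 t := by
    intro IB IW h t ht
    by_cases ho : ∃ u, IsolatedTwo G L u ∧ Private G L u t
    · obtain ⟨u, hu, hut⟩ := ho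
      exact h u hu t hut
    · exact (known_of_no_owner ht fun u hu hut => ho ⟨u, hu, hut⟩).mono (by norm_num)
  by_cases hF : ∃ v s s' q, Fork G L v s s' q
  · obtain ⟨v, s, s', q, hF⟩ := hF
    obtain ⟨b, hb, hbb⟩ := hc.exists_black hF.isolated
    have howner : ∃ c, ∀ u, IsolatedTwo G L u → G.Adj u q → Private G L u c ∧ bl c := by
      by_cases h : ∃ u, IsolatedTwo G L u ∧ G.Adj u q
      · obtain ⟨u, hu, huq⟩ := h
        obtain ⟨c, hc', hbc⟩ := hc.exists_black hu
        refine ⟨c, fun u' hu' huq' => ?_⟩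
        have h1 := hF.owned.private_of_adj hL hu.1 huq.symm
        have h2 := h1.2.2.2 u' hu'.1 huq'.symm
        exact h2 ▸ ⟨hc', hbc⟩
      · exact ⟨b, fun u hu huq => absurd ⟨u, hu, huq⟩ h⟩
    obtain ⟨c, hcc⟩ := howner
    -- A black $q$ in layer 4 may have unboundedly many white neighbors there but at most one black
    -- one. Naming that one as $p$ colors them all; if it does not exist, $p=q$ excludes nothing. In
    -- the remaining cases $q'=x$ has no neighbors in layer 4.
    have hmate : ∃ q' p, (∀ z, L z = 4 → G.Adj q' z → z ≠ p → ¬ bl z) ∧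
        (L q = 4 → bl q → q' = q) := by
      by_cases hq : L q = 4 ∧ bl q
      · by_cases hp : ∃ p, L p = 4 ∧ bl p ∧ G.Adj q p
        · obtain ⟨p, hp4, hbp, hqp⟩ := hp
          exact ⟨q, p, fun z hz hqz hzp hbz =>
            hzp (hc.four_mate hq.1 hz hp4 hq.2 hbz hbp hqz hqp), fun _ _ => rfl⟩
        · exact ⟨q, q, fun z hz hqz _ hbz => hp ⟨z, hz, hbz, hqz⟩, fun _ _ => rfl⟩
      · exact ⟨x, x, fun z hz hxz => absurd hxz (hL.not_adj (by omega)),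
          fun h h' => absurd ⟨h, h'⟩ hq⟩
    obtain ⟨q', p, hp, hq'⟩ := hmate
    refine ⟨[s, s', q, b, c, p], q', p, by simp, hp, fun IB IW hI hl hm => reduce IB IW ?_⟩
    intro u hu t ht
    exact hF.known hG hL hxy hc hI hin (hl s (by simp)) (hl s' (by simp)) (hl q (by simp)) hb hbb
      (hl b (by simp)) (fun u hu huq => ⟨c, (hcc u hu huq).1, (hcc u hu huq).2, hl c (by simp)⟩)
      (fun z hz hq4 hbq hqz hzp => hm z hz (by rwa [hq' hq4 hbq]) hzp) (hl p (by simp)) hu ht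
  · push Not at hF
    obtain ⟨l₁, hl₁, hk₁⟩ := hc.exists_list_of_no_fork hG hL hin hF hx
    obtain ⟨l₂, hl₂, hk₂⟩ := hc.exists_list_of_no_fork hG hL hin hF hy
    refine ⟨l₁ ++ l₂, x, x, by simp; omega,
      fun z hz hxz => absurd hxz (hL.not_adj (by omega)), fun IB IW hI hl _ => reduce IB IW ?_⟩
    intro u hu t ht
    obtain ⟨w, hw, hwu⟩ := hL.exists_adj_one hu.1
    rcases hL.exists_adj_zero hw with h | h
    · exact hk₁ IB IW hI (fun v hv => hl v (by simp [hv])) u w hu hw h.symm hwu t ht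
    · exact hk₂ IB IW hI (fun v hv => hl v (by simp [hv])) u w hu hw h.symm hwu t ht

end Tails

/-! ### Feasible colorings are candidates -/

section Candidates

variable {V : Type*} {G : SimpleGraph V} {x y : V}

variable (G x y) in
/-- The vertices colored black by `B` or forced to be black. -/
def IsBlack (B : Set V) (v : V) : Prop := v ∈ B ∨ v ∈ forcedBlack G x y B

theorem isBlack_iff_mem {B : Set V} {v : V} (hv : depth G x y v ≤ 3) : IsBlack G x y B v ↔ v ∈ B := by
  refine ⟨fun h => h.resolve_right fun h' => ?_, Or.inl⟩
  have := (depth_eq_iff G x y v (by norm_num)).2 h'.1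
  omega

theorem mem_forcedBlack_or_mem_forcedWhite (B : Set V) {z : V} (hz : depth G x y z = 4) :
    z ∈ forcedBlack G x y B ∨ z ∈ forcedWhite G x y B := by
  obtain ⟨t, hzt, ht⟩ := (isLayering_depth G x y).exists_pred hz (by norm_num)
  have hz' := (depth_eq_iff G x y z (by norm_num)).1 hz
  have ht' := (depth_eq_iff G x y t (by norm_num)).1 ht
  by_cases h : t ∈ B
  · exact Or.inr ⟨hz', t, ht', h, hzt.symm⟩
  · exact Or.inl ⟨hz', t, ht', h, hzt.symm⟩

namespace IsFeasibleXYColoring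

variable {B : Set V} (hB : IsFeasibleXYColoring G x y B)
include hB

theorem depth_le {v : V} (hv : v ∈ B) : depth G x y v ≤ 3 :=
  (mem_levelX_iff G x y v).1 (hB.feasible.subset hv)

theorem mem_or_mem {a b : V} (ha : depth G x y a ≤ 3) (hb : depth G x y b ≤ 3) (hab : G.Adj a b) :
    a ∈ B ∨ b ∈ B := by
  by_contra! h
  exact hB.feasible.white_indep ⟨(mem_levelX_iff G x y a).2 ha, h.1⟩
    ⟨(mem_levelX_iff G x y b).2 hb, h.2⟩ hab.ne hab

theorem eq_of_adj {v a b : V} (hv : v ∈ B) (ha : a ∈ B) (hb : b ∈ B) (hva : G.Adj v a)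
    (hvb : G.Adj v b) : a = b :=
  (hB.feasible.black_one v hv).unique ⟨ha, hva⟩ ⟨hb, hvb⟩

theorem not_mem_of_depth_one (hxy : G.Adj x y) {w : V} (hw : depth G x y w = 1) : w ∉ B := by
  have hL := isLayering_depth G x y
  have hx : depth G x y x = 0 := hL.eq_zero.2 (Or.inl rfl)
  have hy : depth G x y y = 0 := hL.eq_zero.2 (Or.inr rfl)
  intro hwB
  rcases hL.exists_adj_zero hw with h | h
  · have := hB.eq_of_adj hB.x_black hwB hB.y_black h.symm hxy
    rw [this, hy] at hw
    omega
  · have := hB.eq_of_adj hB.y_black hwB hB.x_black h.symm hxy.symm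
    rw [this, hx] at hw
    omega

theorem mem_of_depth_two (hxy : G.Adj x y) {u : V} (hu : depth G x y u = 2) : u ∈ B := by
  obtain ⟨w, hw, hwu⟩ := (isLayering_depth G x y).exists_adj_one hu
  exact (hB.mem_or_mem (by omega) (by omega) hwu).resolve_left (hB.not_mem_of_depth_one hxy hw)

theorem isBlack_iff_forced {v : V} (hv : depth G x y v = 4) :
    IsBlack G x y B v ↔ v ∈ forcedBlack G x y B := by
  refine ⟨fun h => h.resolve_left fun h' => ?_, Or.inr⟩
  have := hB.depth_le h'
  omega

theorem not_forced_both {z : V} (h : z ∈ forcedBlack G x y B) : z ∉ forcedWhite G x y B :=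
  fun h' => Set.disjoint_left.1 hB.extends_to_level_four.disjoint (Or.inr h) (Or.inr h')

/-- All of $N_2$ is black, so a neighbor of $u$ in $N_2$ would be a second black neighbor besides
$t$. -/
theorem isolatedTwo_of_mem (hxy : G.Adj x y) {u t : V} (hu : depth G x y u = 2)
    (ht : t ∈ B) (ht3 : depth G x y t = 3) (htu : G.Adj t u) :
    IsolatedTwo G (depth G x y) u := by
  refine ⟨hu, fun w hw huw => ?_⟩
  have := hB.eq_of_adj (hB.mem_of_depth_two hxy hu) ht (hB.mem_of_depth_two hxy hw) htu.symm huw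
  rw [this, hw] at ht3
  omega

theorem private_of_mem (hxy : G.Adj x y) {u t : V} (hu : depth G x y u = 2)
    (ht : t ∈ B) (ht3 : depth G x y t = 3) (htu : G.Adj t u) :
    Private G (depth G x y) u t :=
  ⟨ht3, htu, hu, fun _ hw htw =>
    hB.eq_of_adj ht (hB.mem_of_depth_two hxy hw) (hB.mem_of_depth_two hxy hu) htw htu⟩

theorem isLayerColoring (hxy : G.Adj x y) :
    IsLayerColoring G (depth G x y) (IsBlack G x y B) := by
  have hL := isLayering_depth G x y
  refine ⟨?_, ?_, ?_, ?_, ?_, ?_, ?_, ?_⟩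
  · intro a b ha hb hab
    have := hB.mem_or_mem (by omega) (by omega) hab
    have := hB.not_mem_of_depth_one hxy ha
    have := hB.not_mem_of_depth_one hxy hb
    tauto
  · intro t ht hbt
    rw [isBlack_iff_mem ht.le] at hbt
    obtain ⟨u, htu, hu⟩ := hL.exists_pred ht (by norm_num)
    exact ⟨u, hB.isolatedTwo_of_mem hxy hu hbt ht htu,
      hB.private_of_mem hxy hu hbt ht htu⟩
  · intro t z ht hz htz
    rw [isBlack_iff_mem ht.le]
    rcases hz with hz | hz
    · rw [isBlack_iff_mem hz.le]
      have h1 := hB.mem_or_mem ht.le hz.le htz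
      obtain ⟨u, htu, hu⟩ := hL.exists_pred ht (by norm_num)
      refine ⟨fun h h' => ?_, fun h => h1.resolve_right h⟩
      have := hB.eq_of_adj h h' (hB.mem_of_depth_two hxy hu) htz htu
      rw [this] at hz
      omega
    · rw [hB.isBlack_iff_forced hz]
      have ht' := (depth_eq_iff G x y t (by norm_num)).1 ht
      have hz' := (depth_eq_iff G x y z (by norm_num)).1 hz
      refine ⟨fun h h' => hB.not_forced_both h' ⟨hz', t, ht', h, htz⟩, fun h => ?_⟩
      by_contra h'
      exact h ⟨hz', t, ht', h', htz⟩
  · intro z z' hz hz' hzz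
    rw [hB.isBlack_iff_forced hz, hB.isBlack_iff_forced hz']
    by_contra! h
    exact hB.extends_to_level_four.white_indep (Or.inr ((mem_forcedBlack_or_mem_forcedWhite B hz).resolve_left h.1))
      (Or.inr ((mem_forcedBlack_or_mem_forcedWhite B hz').resolve_left h.2)) hzz.ne hzz
  · intro z a b _ _ _ hbz hba hbb hza hzb
    exact hB.extends_to_level_four.black_le_one z hbz ⟨hba, hza⟩ ⟨hbb, hzb⟩
  · intro u hu
    obtain ⟨t, ⟨ht, hut⟩, -⟩ := hB.feasible.black_one u (hB.mem_of_depth_two hxy hu.1)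
    have h1 := hL.le_of_adj hut
    have h2 := hL.le_of_adj hut.symm
    have h3 : depth G x y t ≠ 1 := fun h => hB.not_mem_of_depth_one hxy h ht
    have h4 : depth G x y t ≠ 2 := fun h => hu.2 t h hut
    have h5 := hu.1
    exact ⟨t, hB.private_of_mem hxy hu.1 ht (by omega) hut.symm, Or.inl ht⟩
  · intro u s t hu hs ht hbs hbt
    rw [isBlack_iff_mem hs.1.le] at hbs
    rw [isBlack_iff_mem ht.1.le] at hbt
    exact hB.eq_of_adj (hB.mem_of_depth_two hxy hu.1) hbs hbt hs.2.1.symm ht.2.1.symm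
  · intro z hz hbz
    obtain ⟨r, hr, hzr⟩ := hB.not_isolated z ((hB.isBlack_iff_forced hz).1 hbz)
    exact ⟨r, hzr, (mem_levelY_iff G x y r).1 hr⟩

end IsFeasibleXYColoring

theorem mem_privateNeighbors_iff {u t : V} (hu : depth G x y u = 2) :
    t ∈ privateNeighbors G x y u ↔ Private G (depth G x y) u t := by
  have h2 : ∀ w, w ∈ level G x y 2 ↔ depth G x y w = 2 := fun w =>
    (depth_eq_iff G x y w (by norm_num)).symm
  have h3 : ∀ w, w ∈ level G x y 3 ↔ depth G x y w = 3 := fun w =>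
    (depth_eq_iff G x y w (by norm_num)).symm
  simp only [privateNeighbors, Private, Set.mem_ofPred_eq, h2, h3, Set.ext_iff,
    Set.mem_singleton_iff]
  refine ⟨fun ⟨ht, h⟩ => ⟨ht, ((h u).2 rfl).2, hu, fun w hw htw => (h w).1 ⟨hw, htw⟩⟩,
    fun ⟨ht, htu, _, h⟩ => ⟨ht, fun w => ⟨fun hw => h w hw.1 hw.2, ?_⟩⟩⟩
  rintro rfl
  exact ⟨hu, htu⟩

theorem AtMostOneInVertex.eq_of_inVertex (h : AtMostOneInVertex G x y) {u s t : V}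
    (hu : IsolatedTwo G (depth G x y) u) (hs : InVertex G (depth G x y) u s)
    (ht : InVertex G (depth G x y) u t) : s = t := by
  have key : ∀ t, InVertex G (depth G x y) u t → t ∈ inVertices G x y u := by
    rintro t ⟨h1, h2, h3⟩
    refine ⟨(mem_privateNeighbors_iff hu.1).2 h1, fun s hs hus => h2 s ?_ ?_, fun s hs => h3 s ?_⟩
    · exact (depth_eq_iff G x y s (by norm_num)).2 hs
    · rwa [← mem_privateNeighbors_iff hu.1]
    · exact (depth_eq_iff G x y s (by norm_num)).2 hs
  exact h u ((depth_eq_iff G x y u (by norm_num)).1 hu.1)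
    (fun w hw => hu.2 w ((depth_eq_iff G x y w (by norm_num)).2 hw)) (key s hs) (key t ht)

/-- The vertices `e i` with `f i = x`. -/
def seedBlack (x : V) (e f : Fin 24 → V) (v : V) : Prop := ∃ i, v = e i ∧ f i = x

variable (G) in
/-- The vertices `e i` with `f i ≠ x`, and the neighbors of `q` in layer `4` other than `p`. -/
def seedWhite (L : V → ℕ) (x : V) (e f : Fin 24 → V) (q p v : V) : Prop :=
  (∃ i, v = e i ∧ f i ≠ x) ∨ (L v = 4 ∧ G.Adj q v ∧ v ≠ p)

variable (G x y) in
/-- The coloring of `X` obtained by three rounds of propagation from the seeds. -/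
def candidate (e f : Fin 24 → V) (q p : V) : Set V :=
  {v | depth G x y v = 0 ∨ depth G x y v = 2 ∨ (depth G x y v = 3 ∧
    (known G (depth G x y) (seedBlack x e f) (seedWhite G (depth G x y) x e f q p) 3).1 v)}

theorem IsFeasibleXYColoring.exists_candidate (hG : IsSpider124Free G) (hxy : G.Adj x y)
    (hin : AtMostOneInVertex G x y) {B : Set V} (hB : IsFeasibleXYColoring G x y B) :
    ∃ e f q p, candidate G x y e f q p = B := by
  classical
  have hL := isLayering_depth G x y
  have hc := hB.isLayerColoring hxy
  obtain ⟨l, q, p, hl, hqp, hknown⟩ := hc.exists_seeds hG hL hxy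
    (fun u hu s t hs ht => hin.eq_of_inVertex hu hs ht)
  -- Short lists are padded with $x$, whose flag is computed like any other. A flag equal to $x$
  -- means black; $y\ne x$ serves as the flag for white.
  let e : Fin 24 → V := fun i => l.getD i x
  let f : Fin 24 → V := fun i => if IsBlack G x y B (e i) then x else y
  have hf : ∀ i, f i = x ↔ IsBlack G x y B (e i) := fun i => by
    by_cases h : IsBlack G x y B (e i)
    · simp [f, h]
    · simp [f, h, hxy.ne.symm]
  have hI : IsSound (IsBlack G x y B) (seedBlack x e f)
      (seedWhite G (depth G x y) x e f q p) := by
    refine ⟨?_, ?_⟩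
    · rintro v ⟨i, rfl, hi⟩
      exact (hf i).1 hi
    · rintro v (⟨i, rfl, hi⟩ | ⟨hv, hqv, hvp⟩)
      · exact fun h => hi ((hf i).2 h)
      · exact hqp v hv hqv hvp
  have hk := hknown _ _ hI (fun v hv => by
      obtain ⟨i, hi, rfl⟩ := List.getElem_of_mem hv
      have he : l[i] = e ⟨i, by omega⟩ := by simp [e, hi]
      by_cases h : f ⟨i, by omega⟩ = x
      · exact Or.inl ⟨_, he, h⟩
      · exact Or.inr (Or.inl ⟨_, he, h⟩))
    (fun z hz hqz hzp => Or.inr (Or.inr ⟨hz, hqz, hzp⟩))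
  refine ⟨e, f, q, p, ?_⟩
  ext v
  constructor
  · rintro (hv | hv | ⟨hv, hkv⟩)
    · rcases hL.eq_zero.1 hv with rfl | rfl
      exacts [hB.x_black, hB.y_black]
    · exact hB.mem_of_depth_two hxy hv
    · exact (isBlack_iff_mem hv.le).1 ((hc.known_sound hI.black hI.white 3).1 v hkv)
  · intro hv
    have h1 := hB.depth_le hv
    have h2 : depth G x y v ≠ 1 := fun h => hB.not_mem_of_depth_one hxy h hv
    by_cases h3 : depth G x y v = 3
    · exact Or.inr (Or.inr ⟨h3, hc.known_black hI (hk v h3) (Or.inl hv)⟩)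
    · have : depth G x y v = 0 ∨ depth G x y v = 2 := by omega
      exact this.imp_right Or.inl

theorem ncard_isFeasibleXYColoring_le [Fintype V] (hG : IsSpider124Free G) (hxy : G.Adj x y)
    (hin : AtMostOneInVertex G x y) :
    {B : Set V | IsFeasibleXYColoring G x y B}.ncard ≤ Fintype.card V ^ 50 := by
  classical
  have hsub : {B : Set V | IsFeasibleXYColoring G x y B} ⊆
      Set.range fun g : (Fin 24 → V) × (Fin 24 → V) × V × V =>
        candidate G x y g.1 g.2.1 g.2.2.1 g.2.2.2 := by
    intro B hB
    obtain ⟨e, f, q, p, h⟩ := IsFeasibleXYColoring.exists_candidate hG hxy hin hB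
    exact ⟨⟨e, f, q, p⟩, h⟩
  calc _ ≤ (Set.range fun g : (Fin 24 → V) × (Fin 24 → V) × V × V =>
        candidate G x y g.1 g.2.1 g.2.2.1 g.2.2.2).ncard :=
        Set.ncard_le_ncard hsub (Set.toFinite _)
    _ ≤ Fintype.card ((Fin 24 → V) × (Fin 24 → V) × V × V) := by
        rw [← Set.image_univ, ← Nat.card_eq_fintype_card, ← Set.ncard_univ]
        exact Set.ncard_image_le (Set.toFinite _)
    _ = Fintype.card V ^ 50 := by
        simp only [Fintype.card_prod, Fintype.card_fun, Fintype.card_fin]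
        ring

end Candidates

/-! ### Polynomial time predicates -/

/-- A graph on `Fin n` with two vertices. -/
structure GraphInput where
  n : ℕ
  G : SimpleGraph (Fin n)
  x : Fin n
  y : Fin n

/-- The store `s` contains the graph `c` in arrays `0` and `1`. -/
structure Represents (c : GraphInput) (s : Store) : Prop where
  adj : ∀ i j : Fin c.n, s 0 i j ≠ 0 ↔ c.G.Adj i j
  size : s 1 0 0 = c.n
  left : s 1 0 1 = c.x
  right : s 1 0 2 = c.y

/-- The first `m` entries of array `4` are the vertices `ρ`. -/
def HoldsVars {m n : ℕ} (ρ : Fin m → Fin n) (s : Store) : Prop := ∀ i : Fin m, s 4 0 i = ρ i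

/-- `s'` differs from `s` only in array `4` from position `m` on and in array `5` from
position `d` on. -/
structure Frame (m d : ℕ) (s s' : Store) : Prop where
  arrays : ∀ a, a ≠ 4 → a ≠ 5 → s' a = s a
  vars : ∀ k < m, s' 4 0 k = s 4 0 k
  slots : ∀ k < d, s' 5 0 k = s 5 0 k

theorem Frame.trans {m d : ℕ} {s s' s'' : Store} (h : Frame m d s s') (h' : Frame m d s' s'') :
    Frame m d s s'' :=
  ⟨fun a h4 h5 => (h'.arrays a h4 h5).trans (h.arrays a h4 h5),
    fun k hk => (h'.vars k hk).trans (h.vars k hk),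
    fun k hk => (h'.slots k hk).trans (h.slots k hk)⟩

theorem Frame.mono {m d m' d' : ℕ} {s s' : Store} (h : Frame m d s s') (hm : m' ≤ m)
    (hd : d' ≤ d) : Frame m' d' s s' :=
  ⟨h.arrays, fun k hk => h.vars k (hk.trans_le hm), fun k hk => h.slots k (hk.trans_le hd)⟩

theorem Frame.write_var {m d k : ℕ} (s : Store) (v : ℕ) (hk : m ≤ k) :
    Frame m d s (s.write 4 0 k v) := by
  refine ⟨fun a h4 h5 => ?_, fun j hj => ?_, fun j hj => ?_⟩
  · funext i j
    simp [Store.write, h4]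
  · have : j ≠ k := by omega
    simp [Store.write, this]
  · simp [Store.write]

theorem Frame.write_slot {m d k : ℕ} (s : Store) (v : ℕ) (hk : d ≤ k) :
    Frame m d s (s.write 5 0 k v) := by
  refine ⟨fun a h4 h5 => ?_, fun j hj => ?_, fun j hj => ?_⟩
  · funext i j
    simp [Store.write, h5]
  · simp [Store.write]
  · have : j ≠ k := by omega
    simp [Store.write, this]

theorem Represents.of_arrays {c : GraphInput} {s s' : Store} (h : Represents c s)
    (h0 : s' 0 = s 0) (h1 : s' 1 = s 1) : Represents c s' :=
  ⟨by rw [h0]; exact h.adj, by rw [h1]; exact h.size, by rw [h1]; exact h.left,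
    by rw [h1]; exact h.right⟩

theorem Represents.of_frame {c : GraphInput} {m d : ℕ} {s s' : Store} (h : Represents c s)
    (hf : Frame m d s s') : Represents c s' :=
  h.of_arrays (hf.arrays 0 (by norm_num) (by norm_num)) (hf.arrays 1 (by norm_num) (by norm_num))

theorem HoldsVars.of_frame {m n d : ℕ} {ρ : Fin m → Fin n} {s s' : Store} (h : HoldsVars ρ s)
    (hf : Frame m d s s') : HoldsVars ρ s' := fun i => (hf.vars i i.2).trans (h i)

theorem HoldsVars.snoc {m n : ℕ} {ρ : Fin m → Fin n} {s : Store} (h : HoldsVars ρ s) {v : Fin n}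
    (hv : s 4 0 m = v) : HoldsVars (Fin.snoc ρ v : Fin (m + 1) → Fin n) s := fun i => by
  refine Fin.lastCases ?_ (fun i => ?_) i
  · simpa using hv
  · simpa using h i

/-- The expression for position `k` of array `4`. -/
def Expr.var (k : ℕ) : Expr := .get 4 (.num 0) (.num k)

/-- The expression for position `d` of array `5`. -/
def Expr.slot (d : ℕ) : Expr := .get 5 (.num 0) (.num d)

/-- The expression for the number of vertices. -/
def Expr.size : Expr := .get 1 (.num 0) (.num 0)

/-- Run `p` with position `k` of array `4` ranging over all vertices. -/
def Prog.forVertex (k : ℕ) (p : Prog) : Prog :=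
  .seq (.set 4 (.num 0) (.num k) (.num 0))
    (.loop (.sub .size (.var k)) (.seq p (.set 4 (.num 0) (.num k) (.add (.var k) (.num 1)))))

theorem Exec.exists_loop {e : Expr} {p : Prog} {I : ℕ → Store → Prop} {N T : ℕ}
    (test : ∀ i s, i ≤ N → I i s → (e.eval s ≠ 0 ↔ i < N))
    (body : ∀ i < N, ∀ s, I i s → ∃ t s', Exec p s t s' ∧ t ≤ T ∧ I (i + 1) s')
    {s : Store} (h0 : I 0 s) :
    ∃ t s', Exec (.loop e p) s t s' ∧ t ≤ N * (T + e.cost + 1) + e.cost + 1 ∧ I N s' := by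
  suffices H : ∀ k i, i + k = N → ∀ s, I i s → ∃ t s', Exec (.loop e p) s t s' ∧
      t ≤ k * (T + e.cost + 1) + e.cost + 1 ∧ I N s' from H N 0 (by omega) s h0
  intro k
  induction k with
  | zero =>
    intro i hi s hs
    obtain rfl : i = N := by omega
    have h : e.eval s = 0 := by
      by_contra h
      exact absurd ((test i s le_rfl hs).1 h) (lt_irrefl _)
    exact ⟨_, s, .loopDone h, by omega, hs⟩
  | succ k ih =>
    intro i hi s hs
    obtain ⟨t, s', hx, ht, hs'⟩ := body i (by omega) s hs
    obtain ⟨t', s'', hx', ht', hs''⟩ := ih (i + 1) (by omega) s' hs'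
    refine ⟨_, s'', .loopStep ((test i s (by omega) hs).2 (by omega)) hx hx', ?_, hs''⟩
    rw [Nat.succ_mul]
    omega

/-- The counter is an ordinary memory cell, so the invariant must survive writes to it, and the body
must leave it unchanged. -/
theorem Exec.exists_forVertex {k : ℕ} {p : Prog} {I : ℕ → Store → Prop} {N T : ℕ}
    (size : ∀ i s, I i s → s 1 0 0 = N)
    (stable : ∀ i s v, I i s → I i (s.write 4 0 k v))
    (body : ∀ i < N, ∀ s, I i s → s 4 0 k = i →
      ∃ t s', Exec p s t s' ∧ t ≤ T ∧ s' 4 0 k = i ∧ I (i + 1) s')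
    {s : Store} (h0 : I 0 s) :
    ∃ t s', Exec (p.forVertex k) s t s' ∧ t ≤ N * (T + 20) + 20 ∧ I N s' := by
  obtain ⟨t, s', hx, ht, hs'⟩ := Exec.exists_loop (e := .sub .size (.var k))
    (p := .seq p (.set 4 (.num 0) (.num k) (.add (.var k) (.num 1))))
    (I := fun i s => I i s ∧ s 4 0 k = i) (N := N) (T := T + 9)
    (fun i s _ hs => by simp [Expr.eval, Expr.size, Expr.var, size i s hs.1, hs.2]; omega)
    (fun i hi s hs => by
      obtain ⟨t, s', hx, ht, hk, hs'⟩ := body i hi s hs.1 hs.2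
      refine ⟨_, _, .seq hx (.set _ _ _ _ _), ?_, stable _ _ _ hs', ?_⟩
      · simp [Expr.cost, Expr.var]
        omega
      · simp [Store.write, Expr.eval, Expr.var, hk])
    (s := s.write 4 0 k 0) ⟨stable _ _ _ h0, by simp [Store.write]⟩
  refine ⟨_, s', .seq (.set _ _ _ _ _) hx, ?_, hs'.1⟩
  simp only [Expr.cost, Expr.size, Expr.var] at ht ⊢
  have : N * (T + 9 + (1 + 1 + 1 + (1 + 1 + 1) + 1) + 1) ≤ N * (T + 20) :=
    Nat.mul_le_mul_left _ (by omega)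
  omega

/-- A program decides the predicate `P` of `m` vertices of a graph in polynomial time. -/
def PolyDec (m : ℕ) (P : ∀ c : GraphInput, (Fin m → Fin c.n) → Prop) : Prop :=
  ∀ d, ∃ (prog : Prog) (p : Polynomial ℕ), ∀ c ρ s, Represents c s → HoldsVars ρ s →
    ∃ t s', Exec prog s t s' ∧ t ≤ p.eval c.n ∧ Frame m d s s' ∧
      (P c ρ → s' 5 0 d = 1) ∧ (¬ P c ρ → s' 5 0 d = 0)

namespace PolyDec

variable {m : ℕ} {P Q : ∀ c : GraphInput, (Fin m → Fin c.n) → Prop}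

theorem congr (h : PolyDec m P) (hPQ : ∀ c ρ, Q c ρ ↔ P c ρ) : PolyDec m Q := by
  have : Q = P := by
    funext c ρ
    exact propext (hPQ c ρ)
  rwa [this]

theorem of_expr (e : Expr) (he : ∀ c ρ s, Represents c s → HoldsVars ρ s →
    (e.eval s ≠ 0 ↔ P c ρ)) : PolyDec m P := by
  intro d
  refine ⟨.ite e (.set 5 (.num 0) (.num d) (.num 1)) (.set 5 (.num 0) (.num d) (.num 0)),
    Polynomial.C (e.cost + 5), fun c ρ s hc hρ => ?_⟩
  by_cases h : e.eval s = 0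
  · refine ⟨_, _, .iteFalse h (.set _ _ _ _ _), by simp [Expr.cost],
      Frame.write_slot s _ le_rfl, fun hP => absurd h ((he c ρ s hc hρ).2 hP), fun _ => ?_⟩
    simp [Store.write, Expr.eval]
  · refine ⟨_, _, .iteTrue h (.set _ _ _ _ _), by simp [Expr.cost],
      Frame.write_slot s _ le_rfl, fun _ => ?_, fun hP => absurd ((he c ρ s hc hρ).1 h) hP⟩
    simp [Store.write, Expr.eval]

theorem const (p : Prop) : PolyDec m (fun _ _ => p) := by
  classical
  refine of_expr (.num (if p then 1 else 0)) fun c ρ s _ _ => ?_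
  by_cases hp : p <;> simp [hp, Expr.eval]

theorem adj (i j : Fin m) : PolyDec m (fun c ρ => c.G.Adj (ρ i) (ρ j)) :=
  of_expr (.get 0 (.var i) (.var j)) fun c ρ s hc hρ => by
    simp only [Expr.eval, Expr.var, hρ i, hρ j]
    exact hc.adj _ _

theorem eq (i j : Fin m) : PolyDec m (fun _ ρ => ρ i = ρ j) :=
  of_expr (.sub (.num 1) (.add (.sub (.var i) (.var j)) (.sub (.var j) (.var i))))
    fun c ρ s hc hρ => by
      simp only [Expr.eval, Expr.var, hρ i, hρ j, Fin.ext_iff]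
      omega

theorem lt (i j : Fin m) : PolyDec m (fun _ ρ => ρ i < ρ j) :=
  of_expr (.sub (.var j) (.var i)) fun c ρ s hc hρ => by
    simp only [Expr.eval, Expr.var, hρ i, hρ j, Fin.lt_def]
    omega

theorem eq_left (i : Fin m) : PolyDec m (fun c ρ => ρ i = c.x) :=
  of_expr (.sub (.num 1) (.add (.sub (.var i) (.get 1 (.num 0) (.num 1)))
    (.sub (.get 1 (.num 0) (.num 1)) (.var i)))) fun c ρ s hc hρ => by
      simp only [Expr.eval, Expr.var, hρ i, hc.left, Fin.ext_iff]
      omega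

theorem eq_right (i : Fin m) : PolyDec m (fun c ρ => ρ i = c.y) :=
  of_expr (.sub (.num 1) (.add (.sub (.var i) (.get 1 (.num 0) (.num 2)))
    (.sub (.get 1 (.num 0) (.num 2)) (.var i)))) fun c ρ s hc hρ => by
      simp only [Expr.eval, Expr.var, hρ i, hc.right, Fin.ext_iff]
      omega

theorem not (h : PolyDec m P) : PolyDec m (fun c ρ => ¬ P c ρ) := by
  intro d
  obtain ⟨prog, p, hp⟩ := h d
  refine ⟨.seq prog (.set 5 (.num 0) (.num d) (.sub (.num 1) (.slot d))),
    p + Polynomial.C 9, fun c ρ s hc hρ => ?_⟩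
  obtain ⟨t, s', hx, ht, hf, h1, h0⟩ := hp c ρ s hc hρ
  refine ⟨_, _, .seq hx (.set _ _ _ _ _), ?_, hf.trans (Frame.write_slot s' _ le_rfl), ?_, ?_⟩
  · simp [Expr.cost, Expr.slot]
    omega
  · intro hP
    simp [Store.write, Expr.eval, Expr.slot, h0 hP]
  · intro hP
    simp [Store.write, Expr.eval, Expr.slot, h1 (not_not.1 hP)]

theorem and (hP : PolyDec m P) (hQ : PolyDec m Q) : PolyDec m (fun c ρ => P c ρ ∧ Q c ρ) := by
  intro d
  obtain ⟨prog, p, hp⟩ := hP d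
  obtain ⟨prog', q, hq⟩ := hQ (d + 1)
  refine ⟨.seq prog (.seq prog' (.ite (.slot d)
    (.set 5 (.num 0) (.num d) (.slot (d + 1))) .skip)),
    p + q + Polynomial.C 13, fun c ρ s hc hρ => ?_⟩
  obtain ⟨t, s', hx, ht, hf, h1, h0⟩ := hp c ρ s hc hρ
  obtain ⟨t', s'', hx', ht', hf', h1', h0'⟩ := hq c ρ s' (hc.of_frame hf) (hρ.of_frame hf)
  have hd : s'' 5 0 d = s' 5 0 d := hf'.slots d (Nat.lt_succ_self d)
  have hf'' := hf.trans (hf'.mono le_rfl (Nat.le_succ d))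
  by_cases h : P c ρ
  · have hne : (Expr.slot d).eval s'' ≠ 0 := by simp [Expr.eval, Expr.slot, hd, h1 h]
    refine ⟨_, _, .seq hx (.seq hx' (.iteTrue hne (.set _ _ _ _ _))), ?_,
      hf''.trans (Frame.write_slot s'' _ le_rfl), ?_, ?_⟩
    · simp [Expr.cost, Expr.slot]
      omega
    · intro hPQ
      simp [Store.write, Expr.eval, Expr.slot, h1' hPQ.2]
    · intro hPQ
      simp [Store.write, Expr.eval, Expr.slot, h0' (fun hQ => hPQ ⟨h, hQ⟩)]
  · have hne : (Expr.slot d).eval s'' = 0 := by simp [Expr.eval, Expr.slot, hd, h0 h]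
    refine ⟨_, _, .seq hx (.seq hx' (.iteFalse hne (.skip _))), ?_, hf'',
      fun hPQ => absurd hPQ.1 h, fun _ => hd.trans (h0 h)⟩
    simp [Expr.cost, Expr.slot]
    omega

theorem or (hP : PolyDec m P) (hQ : PolyDec m Q) : PolyDec m (fun c ρ => P c ρ ∨ Q c ρ) :=
  (hP.not.and hQ.not).not.congr fun c ρ => by tauto

theorem imp (hP : PolyDec m P) (hQ : PolyDec m Q) : PolyDec m (fun c ρ => P c ρ → Q c ρ) :=
  (hP.not.or hQ).congr fun c ρ => by tauto

theorem iff (hP : PolyDec m P) (hQ : PolyDec m Q) : PolyDec m (fun c ρ => P c ρ ↔ Q c ρ) :=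
  ((hP.imp hQ).and (hQ.imp hP)).congr fun c ρ => by tauto

/-- Slot $d$ accumulates the disjunction while the subformula works from slot $d+1$ on and the bound
vertex occupies position $m$, so the enclosing variables and slots are untouched. The loop has no
early exit. -/
theorem ex {Q : ∀ c : GraphInput, (Fin m → Fin c.n) → Fin c.n → Prop}
    (h : PolyDec (m + 1) (fun c ρ => Q c (fun i => ρ i.castSucc) (ρ (Fin.last m)))) :
    PolyDec m (fun c ρ => ∃ v, Q c ρ v) := by
  intro d
  obtain ⟨prog, p, hp⟩ := h (d + 1)
  refine ⟨.seq (.set 5 (.num 0) (.num d) (.num 0)) (.forVertex m (.seq prog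
    (.ite (.slot (d + 1)) (.set 5 (.num 0) (.num d) (.num 1)) .skip))),
    Polynomial.X * (p + Polynomial.C 40) + Polynomial.C 40, fun c ρ s hc hρ => ?_⟩
  obtain ⟨t, s', hx, ht, hf, h1, h0⟩ := Exec.exists_forVertex (k := m)
    (p := .seq prog (.ite (.slot (d + 1)) (.set 5 (.num 0) (.num d) (.num 1)) .skip))
    (I := fun i s' => Frame m d s s' ∧ ((∃ v : Fin c.n, (v : ℕ) < i ∧ Q c ρ v) → s' 5 0 d = 1) ∧
      ((¬ ∃ v : Fin c.n, (v : ℕ) < i ∧ Q c ρ v) → s' 5 0 d = 0)) (N := c.n)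
    (T := p.eval c.n + 10)
    (fun i s' h => (hc.of_frame h.1).size)
    (fun i s' v h => ⟨h.1.trans (Frame.write_var s' v le_rfl), by simpa [Store.write] using h.2⟩)
    (fun i hi s₁ ⟨hf, h1, h0⟩ hv => by
      obtain ⟨t, s₂, hx, ht, hf', h1', h0'⟩ := hp c (Fin.snoc ρ ⟨i, hi⟩) s₁ (hc.of_frame hf)
        ((hρ.of_frame hf).snoc hv)
      simp only [Fin.snoc_castSucc, Fin.snoc_last] at h1' h0'
      have hd : s₂ 5 0 d = s₁ 5 0 d := hf'.slots d (Nat.lt_succ_self d)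
      have hm : s₂ 4 0 m = i := (hf'.vars m (Nat.lt_succ_self m)).trans hv
      have hf'' := hf.trans (hf'.mono (Nat.le_succ m) (Nat.le_succ d))
      by_cases h : Q c ρ ⟨i, hi⟩
      · have hne : (Expr.slot (d + 1)).eval s₂ ≠ 0 := by simp [Expr.eval, Expr.slot, h1' h]
        refine ⟨_, _, .seq hx (.iteTrue hne (.set _ _ _ _ _)), ?_, ?_,
          hf''.trans (Frame.write_slot s₂ _ le_rfl), ?_, ?_⟩
        · simp [Expr.cost, Expr.slot]
          omega
        · simpa [Store.write] using hm
        · intro _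
          simp [Store.write, Expr.eval]
        · intro hn
          exact absurd ⟨⟨i, hi⟩, Nat.lt_succ_self i, h⟩ hn
      · have hne : (Expr.slot (d + 1)).eval s₂ = 0 := by simp [Expr.eval, Expr.slot, h0' h]
        have hiff : (∃ v : Fin c.n, (v : ℕ) < i + 1 ∧ Q c ρ v) ↔
            ∃ v : Fin c.n, (v : ℕ) < i ∧ Q c ρ v := by
          refine ⟨fun ⟨v, hv, hQ⟩ => ⟨v, ?_, hQ⟩, fun ⟨v, hv, hQ⟩ => ⟨v, by omega, hQ⟩⟩
          have : (v : ℕ) ≠ i := by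
            rintro rfl
            exact h hQ
          omega
        refine ⟨_, _, .seq hx (.iteFalse hne (.skip _)), ?_, hm, hf'', ?_, ?_⟩
        · simp [Expr.cost, Expr.slot]
          omega
        · rw [hiff, hd]
          exact h1
        · rw [hiff, hd]
          exact h0)
    (s := s.write 5 0 d 0) ⟨Frame.write_slot s _ le_rfl, fun ⟨v, hv, _⟩ => absurd hv (by omega),
      fun _ => by simp [Store.write]⟩
  refine ⟨_, _, .seq (.set _ _ _ _ _) hx, ?_, hf, fun ⟨v, hv⟩ => h1 ⟨v, v.2, hv⟩,
    fun hn => h0 fun ⟨v, _, hv⟩ => hn ⟨v, hv⟩⟩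
  simp only [Polynomial.eval_add, Polynomial.eval_mul, Polynomial.eval_X, Polynomial.eval_C,
    Expr.cost]
  have : c.n * (p.eval c.n + 10 + 20) ≤ c.n * (p.eval c.n + 40) :=
    Nat.mul_le_mul_left _ (by omega)
  omega

theorem all {Q : ∀ c : GraphInput, (Fin m → Fin c.n) → Fin c.n → Prop}
    (h : PolyDec (m + 1) (fun c ρ => Q c (fun i => ρ i.castSucc) (ρ (Fin.last m)))) :
    PolyDec m (fun c ρ => ∀ v, Q c ρ v) :=
  (ex (Q := fun c ρ v => ¬ Q c ρ v) h.not).not.congr fun c ρ => by simp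

theorem exFin {k : ℕ} {P : Fin k → ∀ c : GraphInput, (Fin m → Fin c.n) → Prop}
    (h : ∀ i, PolyDec m (P i)) : PolyDec m (fun c ρ => ∃ i, P i c ρ) := by
  induction k with
  | zero => exact (const False).congr fun c ρ => by simp
  | succ k ih =>
    exact ((h 0).or (ih fun i => h i.succ)).congr fun c ρ => by simp [Fin.exists_fin_succ]

theorem allFin {k : ℕ} {P : Fin k → ∀ c : GraphInput, (Fin m → Fin c.n) → Prop}
    (h : ∀ i, PolyDec m (P i)) : PolyDec m (fun c ρ => ∀ i, P i c ρ) :=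
  (exFin fun i => (h i).not).not.congr fun c ρ => by simp

theorem exTuple (k : ℕ) {Q : ∀ c : GraphInput, (Fin m → Fin c.n) → (Fin k → Fin c.n) → Prop}
    (h : PolyDec (m + k)
      (fun c ρ => Q c (fun i => ρ (Fin.castAdd k i)) (fun i => ρ (Fin.natAdd m i)))) :
    PolyDec m (fun c ρ => ∃ τ, Q c ρ τ) := by
  induction k with
  | zero =>
    refine h.congr fun c ρ => ⟨fun ⟨τ, hτ⟩ => ?_, fun h => ⟨_, h⟩⟩
    have hτ' : τ = fun i => ρ (Fin.natAdd m i) := funext fun i => i.elim0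
    rwa [hτ'] at hτ
  | succ k ih =>
    have h' : PolyDec (m + k) (fun c ρ => ∃ v, Q c (fun i => ρ (Fin.castAdd k i))
        (Fin.snoc (fun i => ρ (Fin.natAdd m i)) v)) := by
      refine ex (h.congr fun c ρ => ?_)
      refine iff_of_eq (congrArg₂ (Q c) rfl ?_)
      funext i
      refine Fin.lastCases ?_ (fun i => ?_) i
      · simp
      · simp
    refine (ih (Q := fun c ρ τ => ∃ v, Q c ρ (Fin.snoc τ v)) h').congr fun c ρ => ?_
    refine ⟨fun ⟨τ, hτ⟩ => ⟨Fin.init τ, τ (Fin.last k), ?_⟩, fun ⟨τ, v, h⟩ => ⟨_, h⟩⟩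
    rwa [Fin.snoc_init_self]

end PolyDec

/-! ### The predicates of the algorithm -/

/-- The depth of a vertex of the input graph. -/
noncomputable abbrev GraphInput.depth (c : GraphInput) : Fin c.n → ℕ := _root_.depth c.G c.x c.y

/-- This makes "depth at most $k$" a first-order formula by recursion, so no graph search has to be
programmed. The bound on $k$ is needed because a vertex of truncated depth 5 need not have a
predecessor. -/
theorem IsLayering.le_succ_iff {V : Type*} {G : SimpleGraph V} {x y : V} {L : V → ℕ}
    (hL : IsLayering G x y L) {k : ℕ} (hk : k < 4) (v : V) :
    L v ≤ k + 1 ↔ ∃ w, (w = v ∨ G.Adj v w) ∧ L w ≤ k := by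
  constructor
  · intro h
    by_cases h' : L v ≤ k
    · exact ⟨v, Or.inl rfl, h'⟩
    · obtain ⟨w, hw, hw'⟩ := hL.exists_pred (a := v) (i := k) (by omega) hk
      exact ⟨w, Or.inr hw, hw'.le⟩
  · rintro ⟨w, rfl | hw, h⟩
    · omega
    · have := hL.le_of_adj hw.symm
      omega

namespace PolyDec

variable {m : ℕ}

theorem depth_le {k : ℕ} (hk : k ≤ 4) (i : Fin m) : PolyDec m (fun c ρ => c.depth (ρ i) ≤ k) := by
  induction k generalizing m with
  | zero =>
    exact ((eq_left i).or (eq_right i)).congr fun c ρ =>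
      Nat.le_zero.trans (isLayering_depth c.G c.x c.y).eq_zero
  | succ k ih =>
    refine PolyDec.congr (ex (Q := fun c ρ w => (w = ρ i ∨ c.G.Adj (ρ i) w) ∧ c.depth w ≤ k) ?_)
      fun c ρ => (isLayering_depth c.G c.x c.y).le_succ_iff (by omega) (ρ i)
    exact ((eq _ _).or (adj _ _)).and (ih (by omega) _)

theorem depth_eq {k : ℕ} (hk : k ≤ 4) (i : Fin m) : PolyDec m (fun c ρ => c.depth (ρ i) = k) := by
  cases k with
  | zero => exact (depth_le hk i).congr fun c ρ => by omega
  | succ k =>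
    exact ((depth_le hk i).and (depth_le (k := k) (by omega) i).not).congr fun c ρ => by omega

theorem isolatedTwo (i : Fin m) : PolyDec m (fun c ρ => IsolatedTwo c.G c.depth (ρ i)) :=
  (depth_eq (by norm_num) _).and (all ((depth_eq (by norm_num) _).imp (adj _ _).not))

theorem private_ (i j : Fin m) : PolyDec m (fun c ρ => Private c.G c.depth (ρ i) (ρ j)) :=
  (depth_eq (by norm_num) _).and ((adj _ _).and ((depth_eq (by norm_num) _).and
    (all ((depth_eq (by norm_num) _).imp ((adj _ _).imp (eq _ _))))))

theorem bichromaticEdge (i j : Fin m) :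
    PolyDec m (fun c ρ => BichromaticEdge c.G c.depth (ρ i) (ρ j)) :=
  (adj _ _).and (((depth_eq (by norm_num) _).and ((depth_eq (by norm_num) _).or
    (depth_eq (by norm_num) _))).or ((depth_eq (by norm_num) _).and (depth_eq (by norm_num) _)))

end PolyDec

/-- The set `K c ρ` of vertices is decidable in polynomial time, given `m` vertices `ρ`. -/
def PolyRel (m : ℕ) (K : ∀ c : GraphInput, (Fin m → Fin c.n) → Fin c.n → Prop) : Prop :=
  ∀ (m' : ℕ) (ι : Fin m → Fin m') (j : Fin m'), PolyDec m' (fun c ρ => K c (fun i => ρ (ι i)) (ρ j))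

namespace PolyRel

open PolyDec

variable {m : ℕ} {KB KW : ∀ c : GraphInput, (Fin m → Fin c.n) → Fin c.n → Prop}

/-- The free reindexing in `PolyRel` is what allows testing `KW` at vertices bound by the
quantifiers of a rule. -/
theorem stepBlack (hB : PolyRel m KB) (hW : PolyRel m KW) :
    PolyRel m (fun c ρ => stepBlack c.G c.depth (KB c ρ) (KW c ρ)) := by
  intro m' ι j
  refine (hB _ _ _).or (or ?_ (or ?_ (or ?_ ?_)))
  · exact ex ((bichromaticEdge _ _).and (hW _ _ _))
  · exact (depth_eq (by norm_num) _).and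
      (ex ((depth_eq (by norm_num) _).and ((adj _ _).and (hW _ _ _))))
  · exact ex ((isolatedTwo _).and ((private_ _ _).and
      (all ((private_ _ _).imp ((eq _ _).not.imp (hW _ _ _))))))
  · exact (depth_eq (by norm_num) _).and (ex ((depth_eq (by norm_num) _).and ((adj _ _).and
      (all ((adj _ _).imp (depth_le (by norm_num) _))))))

theorem stepWhite (hB : PolyRel m KB) (hW : PolyRel m KW) :
    PolyRel m (fun c ρ => stepWhite c.G c.depth (KB c ρ) (KW c ρ)) := by
  intro m' ι j
  refine (hW _ _ _).or (or ?_ (or ?_ (or ?_ (or ?_ ?_))))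
  · exact ex ((bichromaticEdge _ _).and (hB _ _ _))
  · exact (depth_eq (by norm_num) _).and (all ((isolatedTwo _).imp (private_ _ _).not))
  · exact ex ((isolatedTwo _).and ((private_ _ _).and
      (ex ((private_ _ _).and ((eq _ _).not.and (hB _ _ _))))))
  · exact (depth_eq (by norm_num) _).and (ex (ex ((depth_eq (by norm_num) _).and
      ((depth_eq (by norm_num) _).and ((adj _ _).and ((adj _ _).and (adj _ _)))))))
  · exact ex ((isolatedTwo _).and ((private_ _ _).and (ex (ex ((private_ _ _).and
      ((eq _ _).not.and (((depth_eq (by norm_num) _).or (depth_eq (by norm_num) _)).and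
        ((adj _ _).and (adj _ _)))))))))

theorem known (hB : PolyRel m KB) (hW : PolyRel m KW) (r : ℕ) :
    PolyRel m (fun c ρ => (known c.G c.depth (KB c ρ) (KW c ρ) r).1) ∧
      PolyRel m (fun c ρ => (_root_.known c.G c.depth (KB c ρ) (KW c ρ) r).2) := by
  induction r with
  | zero => exact ⟨hB, hW⟩
  | succ r ih => exact ⟨ih.1.stepBlack ih.2, ih.1.stepWhite ih.2⟩

end PolyRel

/-- The candidate coloring given by `50` vertices. -/
def GraphInput.candidate (c : GraphInput) (ρ : Fin 50 → Fin c.n) : Set (Fin c.n) :=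
  _root_.candidate c.G c.x c.y (fun i => ρ ⟨i, by omega⟩) (fun i => ρ ⟨24 + i, by omega⟩)
    (ρ 48) (ρ 49)

theorem polyRel_candidate : PolyRel 50 (fun c ρ v => v ∈ c.candidate ρ) := by
  have hB : PolyRel 50 (fun c ρ => seedBlack c.x (fun i : Fin 24 => ρ ⟨i, by omega⟩)
      (fun i : Fin 24 => ρ ⟨24 + i, by omega⟩)) := fun m ι j =>
    PolyDec.exFin fun i => (PolyDec.eq _ _).and (PolyDec.eq_left _)
  have hW : PolyRel 50 (fun c ρ => seedWhite c.G c.depth c.x (fun i : Fin 24 => ρ ⟨i, by omega⟩)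
      (fun i : Fin 24 => ρ ⟨24 + i, by omega⟩) (ρ 48) (ρ 49)) := fun m ι j =>
    (PolyDec.exFin fun i => (PolyDec.eq _ _).and (PolyDec.eq_left _).not).or
      ((PolyDec.depth_eq (by norm_num) _).and ((PolyDec.adj _ _).and (PolyDec.eq _ _).not))
  exact fun m ι j => (PolyDec.depth_eq (by norm_num) _).or ((PolyDec.depth_eq (by norm_num) _).or
    ((PolyDec.depth_eq (by norm_num) _).and ((hB.known hW 3).1 m ι j)))

theorem GraphInput.exists_candidate (c : GraphInput) (hG : IsSpider124Free c.G)
    (hxy : c.G.Adj c.x c.y) (hin : AtMostOneInVertex c.G c.x c.y) {B : Set (Fin c.n)}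
    (hB : IsFeasibleXYColoring c.G c.x c.y B) : ∃ ρ, c.candidate ρ = B := by
  obtain ⟨e, f, q, p, h⟩ := hB.exists_candidate hG hxy hin
  refine ⟨fun i => if h : (i : ℕ) < 24 then e ⟨i, h⟩ else if h : (i : ℕ) - 24 < 24 then
    f ⟨i - 24, h⟩ else if (i : ℕ) = 48 then q else p, ?_⟩
  rw [← h, GraphInput.candidate]
  congr 1
  · funext i
    simp
  · funext i
    simp

section Feasible

variable {V : Type*} (G : SimpleGraph V) (x y : V) (B : Set V)

theorem mem_forcedBlack_iff (z : V) : z ∈ forcedBlack G x y B ↔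
    depth G x y z = 4 ∧ ∃ t, depth G x y t = 3 ∧ t ∉ B ∧ G.Adj t z := by
  simp only [forcedBlack, Set.mem_ofPred_eq, ← depth_eq_iff G x y _ (show 4 < 5 by norm_num),
    ← depth_eq_iff G x y _ (show 3 < 5 by norm_num)]

theorem mem_forcedWhite_iff (z : V) : z ∈ forcedWhite G x y B ↔
    depth G x y z = 4 ∧ ∃ t, depth G x y t = 3 ∧ t ∈ B ∧ G.Adj t z := by
  simp only [forcedWhite, Set.mem_ofPred_eq, ← depth_eq_iff G x y _ (show 4 < 5 by norm_num),
    ← depth_eq_iff G x y _ (show 3 < 5 by norm_num)]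

/-- The right side is spelled out as a first-order formula in depth, adjacency and membership, in
exactly the shape that the combinators of `PolyDec` build. -/
theorem isFeasibleXYColoring_iff : IsFeasibleXYColoring G x y B ↔
    (∃ v, v = x ∧ v ∈ B) ∧ (∃ v, v = y ∧ v ∈ B) ∧ (∀ v, v ∈ B → depth G x y v ≤ 3) ∧
    (∀ v w, depth G x y v ≤ 3 ∧ v ∉ B → depth G x y w ≤ 3 ∧ w ∉ B → ¬ v = w → ¬ G.Adj v w) ∧
    (∀ v, v ∈ B → ∃ w, (w ∈ B ∧ G.Adj v w) ∧ ∀ u, u ∈ B ∧ G.Adj v u → u = w) ∧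
    (∀ v, v ∈ B ∨ v ∈ forcedBlack G x y B →
      ¬ ((depth G x y v ≤ 3 ∧ v ∉ B) ∨ v ∈ forcedWhite G x y B)) ∧
    (∀ v w, (depth G x y v ≤ 3 ∧ v ∉ B) ∨ v ∈ forcedWhite G x y B →
      (depth G x y w ≤ 3 ∧ w ∉ B) ∨ w ∈ forcedWhite G x y B → ¬ v = w → ¬ G.Adj v w) ∧
    (∀ v, v ∈ B ∨ v ∈ forcedBlack G x y B → ∀ a b,
      (a ∈ B ∨ a ∈ forcedBlack G x y B) ∧ G.Adj v a →
      (b ∈ B ∨ b ∈ forcedBlack G x y B) ∧ G.Adj v b → a = b) ∧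
    (∀ z, z ∈ forcedBlack G x y B → ∃ r, ¬ depth G x y r ≤ 3 ∧ G.Adj z r) := by
  have hX := mem_levelX_iff G x y
  constructor
  · intro h
    refine ⟨⟨x, rfl, h.x_black⟩, ⟨y, rfl, h.y_black⟩, fun v hv => (hX v).1 (h.feasible.subset hv),
      fun v w hv hw hvw => h.feasible.white_indep ⟨(hX v).2 hv.1, hv.2⟩ ⟨(hX w).2 hw.1, hw.2⟩ hvw,
      h.feasible.black_one, fun v hv hv' => ?_, fun v w hv hw hvw => ?_, fun v hv a b ha hb =>
        h.extends_to_level_four.black_le_one v hv ha hb, fun z hz => ?_⟩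
    · exact Set.disjoint_left.1 h.extends_to_level_four.disjoint hv
        (hv'.imp_left fun h => ⟨(hX v).2 h.1, h.2⟩)
    · exact h.extends_to_level_four.white_indep (hv.imp_left fun h => ⟨(hX v).2 h.1, h.2⟩)
        (hw.imp_left fun h => ⟨(hX w).2 h.1, h.2⟩) hvw
    · obtain ⟨r, hr, hzr⟩ := h.not_isolated z hz
      exact ⟨r, fun h => hr ((hX r).2 h), hzr⟩
  · rintro ⟨⟨x', rfl, h1⟩, ⟨y', rfl, h2⟩, h3, h4, h5, h6, h7, h8, h9⟩
    refine ⟨h1, h2, ⟨fun v hv => (hX v).2 (h3 v hv), fun v hv w hw hvw => ?_, h5⟩,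
      ⟨Set.disjoint_left.2 fun v hv hv' => ?_, fun v hv w hw hvw => ?_, fun v hv a ha b hb => ?_⟩,
      fun z hz => ?_⟩
    · exact h4 v w ⟨(hX v).1 hv.1, hv.2⟩ ⟨(hX w).1 hw.1, hw.2⟩ hvw
    · exact h6 v hv (hv'.imp_left fun h => ⟨(hX v).1 h.1, h.2⟩)
    · exact h7 v w (hv.imp_left fun h => ⟨(hX v).1 h.1, h.2⟩)
        (hw.imp_left fun h => ⟨(hX w).1 h.1, h.2⟩) hvw
    · exact h8 v hv a b ha hb
    · obtain ⟨r, hr, hzr⟩ := h9 z hz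
      exact ⟨r, fun h => hr ((hX r).1 h), hzr⟩

end Feasible

open PolyDec in
theorem polyDec_isFeasibleXYColoring {m : ℕ}
    {B : ∀ c : GraphInput, (Fin m → Fin c.n) → Set (Fin c.n)}
    (hB : PolyRel m (fun c ρ v => v ∈ B c ρ)) :
    PolyDec m (fun c ρ => IsFeasibleXYColoring c.G c.x c.y (B c ρ)) := by
  have hFB : PolyRel m (fun c ρ v => v ∈ forcedBlack c.G c.x c.y (B c ρ)) := fun m' ι j =>
    PolyDec.congr ((depth_eq (by norm_num) _).and
      (ex ((depth_eq (by norm_num) _).and ((hB _ _ _).not.and (adj _ _)))))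
      fun c ρ => mem_forcedBlack_iff c.G c.x c.y _ (ρ j)
  have hFW : PolyRel m (fun c ρ v => v ∈ forcedWhite c.G c.x c.y (B c ρ)) := fun m' ι j =>
    PolyDec.congr ((depth_eq (by norm_num) _).and
      (ex ((depth_eq (by norm_num) _).and ((hB _ _ _).and (adj _ _)))))
      fun c ρ => mem_forcedWhite_iff c.G c.x c.y _ (ρ j)
  have hwhite : PolyRel m (fun c ρ v => c.depth v ≤ 3 ∧ v ∉ B c ρ) := fun m' ι j =>
    (depth_le (by norm_num) _).and (hB _ _ _).not
  refine PolyDec.congr ?_ fun c ρ => isFeasibleXYColoring_iff c.G c.x c.y (B c ρ)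
  refine and ?_ (and ?_ (and ?_ (and ?_ (and ?_ (and ?_ (and ?_ (and ?_ ?_)))))))
  · exact ex ((eq_left _).and (hB _ _ _))
  · exact ex ((eq_right _).and (hB _ _ _))
  · exact all ((hB _ _ _).imp (depth_le (by norm_num) _))
  · exact all (all ((hwhite _ _ _).imp ((hwhite _ _ _).imp ((eq _ _).not.imp (adj _ _).not))))
  · exact all ((hB _ _ _).imp (ex (((hB _ _ _).and (adj _ _)).and
      (all (((hB _ _ _).and (adj _ _)).imp (eq _ _))))))
  · exact all (((hB _ _ _).or (hFB _ _ _)).imp ((hwhite _ _ _).or (hFW _ _ _)).not)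
  · exact all (all (((hwhite _ _ _).or (hFW _ _ _)).imp (((hwhite _ _ _).or (hFW _ _ _)).imp
      ((eq _ _).not.imp (adj _ _).not))))
  · exact all (((hB _ _ _).or (hFB _ _ _)).imp (all (all
      ((((hB _ _ _).or (hFB _ _ _)).and (adj _ _)).imp
        ((((hB _ _ _).or (hFB _ _ _)).and (adj _ _)).imp (eq _ _))))))
  · exact all ((hFB _ _ _).imp (ex ((depth_le (by norm_num) _).not.and (adj _ _))))

/-! ### Enumeration -/

/-- The output part of the store `s` is the list `l`. -/
structure Outputs {n : ℕ} (l : List (Set (Fin n))) (s : Store) : Prop where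
  length : outputLength s = l.length
  row : ∀ (k : ℕ) (hk : k < l.length), outputSet n s k = l[k]

theorem Outputs.of_arrays {n : ℕ} {l : List (Set (Fin n))} {s s' : Store} (h : Outputs l s)
    (h2 : s' 2 = s 2) (h3 : s' 3 = s 3) : Outputs l s' :=
  ⟨by rw [outputLength, h2]; exact h.length, fun k hk => by rw [outputSet, h3]; exact h.row k hk⟩

theorem Outputs.of_frame {n m d : ℕ} {l : List (Set (Fin n))} {s s' : Store} (h : Outputs l s)
    (hf : Frame m d s s') : Outputs l s' :=
  h.of_arrays (hf.arrays 2 (by norm_num) (by norm_num)) (hf.arrays 3 (by norm_num) (by norm_num))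

/-- A program appends the list `f c ρ` to the output, in polynomial time. -/
def PolyEmits (m : ℕ) (f : ∀ c : GraphInput, (Fin m → Fin c.n) → List (Set (Fin c.n))) : Prop :=
  ∃ (prog : Prog) (p : Polynomial ℕ), ∀ c ρ s l, Represents c s → HoldsVars ρ s → Outputs l s →
    ∃ t s', Exec prog s t s' ∧ t ≤ p.eval c.n ∧ Represents c s' ∧ HoldsVars ρ s' ∧
      Outputs (l ++ f c ρ) s'

open Classical in
theorem PolyEmits.of_polyDec {m : ℕ} {P : ∀ c : GraphInput, (Fin m → Fin c.n) → Prop}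
    {B : ∀ c : GraphInput, (Fin m → Fin c.n) → Set (Fin c.n)} (hP : PolyDec m P)
    (hB : PolyRel m (fun c ρ v => v ∈ B c ρ)) :
    PolyEmits m (fun c ρ => if P c ρ then [B c ρ] else []) := by
  obtain ⟨prog, p, hp⟩ := hP 0
  obtain ⟨prog', q, hq⟩ := hB (m + 1) Fin.castSucc (Fin.last m) 0
  let body : Prog := .seq prog' (.set 3 (.get 2 (.num 0) (.num 0)) (.var m) (.slot 0))
  let next : Prog := .set 2 (.num 0) (.num 0) (.add (.get 2 (.num 0) (.num 0)) (.num 1))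
  refine ⟨.seq prog (.ite (.slot 0) (.seq (body.forVertex m) next) .skip),
    p + Polynomial.X * (q + Polynomial.C 40) + Polynomial.C 60, fun c ρ s l hc hρ hl => ?_⟩
  obtain ⟨t, s₁, hx, ht, hf, h1, h0⟩ := hp c ρ s hc hρ
  by_cases h : P c ρ
  swap
  · have hne : (Expr.slot 0).eval s₁ = 0 := by simp [Expr.eval, Expr.slot, h0 h]
    refine ⟨_, _, .seq hx (.iteFalse hne (.skip _)), ?_, hc.of_frame hf, hρ.of_frame hf, ?_⟩
    · simp only [Polynomial.eval_add, Polynomial.eval_mul, Polynomial.eval_X, Polynomial.eval_C,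
        Expr.cost, Expr.slot]
      omega
    · simpa [h] using hl.of_frame hf
  have hne : (Expr.slot 0).eval s₁ ≠ 0 := by simp [Expr.eval, Expr.slot, h1 h]
  -- The new row has index `l.length`, just beyond the current output, so `Outputs l` persists until
  -- the length is increased after the loop.
  obtain ⟨t', s₂, hx', ht', hc', hρ', hl', hrow⟩ := Exec.exists_forVertex (k := m) (p := body)
    (I := fun i s' => Represents c s' ∧ HoldsVars ρ s' ∧ Outputs l s' ∧
      ∀ v : Fin c.n, (v : ℕ) < i → (s' 3 l.length v = 1 ↔ v ∈ B c ρ)) (N := c.n)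
    (T := q.eval c.n + 20)
    (fun i s' h => h.1.size)
    (fun i s' v ⟨h1, h2, h3, h4⟩ => ⟨h1.of_frame (Frame.write_var (m := m) (d := 0) s' v le_rfl),
      h2.of_frame (Frame.write_var (d := 0) s' v le_rfl),
      h3.of_frame (Frame.write_var (m := m) (d := 0) s' v le_rfl), by simpa [Store.write] using h4⟩)
    (fun i hi s₁ ⟨hc, hρ, hl, hrow⟩ hv => by
      obtain ⟨t, s₂, hx, ht, hf, h1, h0⟩ := hq c (Fin.snoc ρ ⟨i, hi⟩) s₁ hc (hρ.snoc hv)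
      simp only [Fin.snoc_castSucc, Fin.snoc_last] at h1 h0
      have hm : s₂ 4 0 m = i := (hf.vars m (Nat.lt_succ_self m)).trans hv
      have hlen : s₂ 2 0 0 = l.length := (hl.of_frame hf).length
      have h3 : s₂ 3 = s₁ 3 := hf.arrays 3 (by norm_num) (by norm_num)
      have hf' : Frame m 0 s₁ s₂ := hf.mono (Nat.le_succ m) le_rfl
      refine ⟨_, _, .seq hx (.set _ _ _ _ _), ?_, ?_, ?_, ?_, ?_, ?_⟩
      · simp [Expr.cost, Expr.slot, Expr.var]
        omega
      · simpa [Store.write] using hm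
      · refine (hc.of_frame hf).of_arrays ?_ ?_ <;> · funext; simp [Store.write]
      · intro j
        simpa [Store.write] using hρ.of_frame hf' j
      · refine ⟨by simpa [Store.write, outputLength] using (hl.of_frame hf).length,
          fun k hk => ?_⟩
        rw [← (hl.of_frame hf).row k hk]
        ext v
        have : k ≠ l.length := hk.ne
        simp [outputSet, Store.write, Expr.eval, hlen, this]
      · intro v hv'
        by_cases hvi : (v : ℕ) = i
        · obtain rfl : v = ⟨i, hi⟩ := Fin.ext hvi
          by_cases hB : (⟨i, hi⟩ : Fin c.n) ∈ B c ρ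
          · simp [Store.write, Expr.eval, Expr.var, Expr.slot, hlen, hm, hB, h1 hB]
          · simp [Store.write, Expr.eval, Expr.var, Expr.slot, hlen, hm, hB, h0 hB]
        · simp [Store.write, Expr.eval, Expr.var, hlen, hm, hvi, h3,
            hrow v (by omega)])
    (s := s₁) ⟨hc.of_frame hf, hρ.of_frame hf, hl.of_frame hf, fun v hv => absurd hv (by omega)⟩
  refine ⟨_, _, .seq hx (.iteTrue hne (.seq hx' (.set _ _ _ _ _))), ?_, ?_, ?_, ?_⟩
  · simp only [Polynomial.eval_add, Polynomial.eval_mul, Polynomial.eval_X, Polynomial.eval_C,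
      Expr.cost, Expr.slot]
    have : c.n * (q.eval c.n + 20 + 20) = c.n * (q.eval c.n + 40) := by ring
    omega
  · refine hc'.of_arrays ?_ ?_ <;> · funext; simp [Store.write]
  · intro j
    simpa [Store.write] using hρ' j
  · have hlen : s₂ 2 0 0 = l.length := hl'.length
    simp only [h, if_true]
    refine ⟨by simp [outputLength, Store.write, Expr.eval, hlen], fun k hk => ?_⟩
    by_cases hkl : k < l.length
    · rw [List.getElem_append_left hkl, ← hl'.row k hkl]
      simp [outputSet, Store.write]
    · have hk' : k = l.length := by
        simp at hk
        omega
      subst hk'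
      simp only [le_refl, List.getElem_append_right, Nat.sub_self, List.getElem_cons_zero]
      ext v
      simpa [outputSet, Store.write] using hrow v v.2

theorem PolyEmits.flatMap {m : ℕ}
    {f : ∀ c : GraphInput, (Fin (m + 1) → Fin c.n) → List (Set (Fin c.n))}
    (hf : PolyEmits (m + 1) f) : PolyEmits m (fun c ρ =>
      (List.finRange c.n).flatMap fun v => f c (Fin.snoc ρ v : Fin (m + 1) → Fin c.n)) := by
  obtain ⟨prog, p, hp⟩ := hf
  refine ⟨prog.forVertex m, Polynomial.X * (p + Polynomial.C 20) + Polynomial.C 20,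
    fun c ρ s l hc hρ hl => ?_⟩
  obtain ⟨t, s', hx, ht, hc', hρ', hl'⟩ := Exec.exists_forVertex (k := m) (p := prog)
    (I := fun i s' => Represents c s' ∧ HoldsVars ρ s' ∧
      Outputs (l ++ ((List.finRange c.n).take i).flatMap
        fun v => f c (Fin.snoc ρ v : Fin (m + 1) → Fin c.n)) s') (N := c.n)
    (T := p.eval c.n)
    (fun i s' h => h.1.size)
    (fun i s' v ⟨h1, h2, h3⟩ => ⟨h1.of_frame (Frame.write_var (m := m) (d := 0) s' v le_rfl),
      h2.of_frame (Frame.write_var (d := 0) s' v le_rfl),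
      h3.of_frame (Frame.write_var (m := m) (d := 0) s' v le_rfl)⟩)
    (fun i hi s₁ ⟨hc, hρ, hl⟩ hv => by
      obtain ⟨t, s₂, hx, ht, hc', hρ', hl'⟩ := hp c (Fin.snoc ρ ⟨i, hi⟩) s₁ _ hc (hρ.snoc hv) hl
      refine ⟨t, s₂, hx, ht, ?_, hc', fun j => ?_, ?_⟩
      · simpa using hρ' (Fin.last m)
      · simpa using hρ' j.castSucc
      · rw [List.take_add_one]
        simpa [hi] using hl')
    (s := s) ⟨hc, hρ, by simpa using hl⟩
  refine ⟨t, s', hx, by simpa using ht, hc', hρ', ?_⟩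
  rwa [List.take_of_length_le (by simp)] at hl'

/-- The lists for all `m`-tuples of vertices can be emitted one after the other. -/
theorem PolyEmits.exists_forall {m : ℕ}
    {f : ∀ c : GraphInput, (Fin m → Fin c.n) → List (Set (Fin c.n))} (hf : PolyEmits m f) :
    ∃ g : ∀ c : GraphInput, (Fin 0 → Fin c.n) → List (Set (Fin c.n)), PolyEmits 0 g ∧
      ∀ c τ, (∀ B, B ∈ g c τ ↔ ∃ ρ, B ∈ f c ρ) ∧ ((∀ ρ, (f c ρ).Nodup) →
        (∀ ρ ρ', ρ ≠ ρ' → List.Disjoint (f c ρ) (f c ρ')) → (g c τ).Nodup) := by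
  induction m with
  | zero =>
    refine ⟨f, hf, fun c τ => ⟨fun B => ⟨fun h => ⟨τ, h⟩, ?_⟩, fun h _ => h τ⟩⟩
    rintro ⟨ρ, h⟩
    rwa [Subsingleton.elim τ ρ]
  | succ m ih =>
    -- The last variable becomes the innermost loop and is absorbed into the emitted list.
    obtain ⟨g, hg, hfg⟩ := ih hf.flatMap
    refine ⟨g, hg, fun c τ => ⟨fun B => ?_, fun h1 h2 => (hfg c τ).2 (fun ρ => ?_) ?_⟩⟩
    · rw [(hfg c τ).1 B]
      simp only [List.mem_flatMap, List.mem_finRange, true_and]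
      refine ⟨fun ⟨ρ, v, h⟩ => ⟨_, h⟩, fun ⟨ρ, h⟩ => ⟨Fin.init ρ, ρ (Fin.last m), ?_⟩⟩
      rwa [Fin.snoc_init_self]
    · refine List.nodup_flatMap.2 ⟨fun v _ => h1 _, ?_⟩
      refine (List.nodup_finRange c.n).imp fun {v w} hvw => h2 _ _ fun h => hvw ?_
      simpa using congrFun h (Fin.last m)
    · intro ρ ρ' hρ B hB hB'
      simp only [List.mem_flatMap, List.mem_finRange, true_and] at hB hB'
      obtain ⟨v, hv⟩ := hB
      obtain ⟨w, hw⟩ := hB'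
      refine h2 _ _ (fun h => hρ ?_) hv hw
      funext i
      simpa using congrFun h i.castSucc

/-- The lexicographic order of tuples. -/
def LexLT {k n : ℕ} (τ ρ : Fin k → Fin n) : Prop := ∃ i, (∀ j, j < i → τ j = ρ j) ∧ τ i < ρ i

theorem LexLT.trichotomy {k n : ℕ} {τ ρ : Fin k → Fin n} (h : τ ≠ ρ) : LexLT τ ρ ∨ LexLT ρ τ := by
  have h' : toLex τ ≠ toLex ρ := fun e => h e
  -- `LexLT` unfolds to the strict order on `Lex (Fin k → Fin n)`.
  exact lt_or_gt_of_ne h'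

theorem LexLT.exists_min {k n : ℕ} {p : (Fin k → Fin n) → Prop} (h : ∃ ρ, p ρ) :
    ∃ ρ, p ρ ∧ ∀ τ, LexLT τ ρ → ¬ p τ := by
  obtain ⟨ρ, hρ⟩ := h
  obtain ⟨a, ha, hmin⟩ := (wellFounded_lt (α := Lex (Fin k → Fin n))).has_min
    {a | p (ofLex a)} ⟨toLex ρ, hρ⟩
  exact ⟨ofLex a, ha, fun τ hτ hp => hmin (toLex τ) hp hτ⟩

/-- The candidate for `ρ` is feasible, and no lexicographically smaller tuple gives the same one. -/
def GraphInput.IsOutput (c : GraphInput) (ρ : Fin 50 → Fin c.n) : Prop :=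
  IsFeasibleXYColoring c.G c.x c.y (c.candidate ρ) ∧
    ¬ ∃ τ, LexLT τ ρ ∧ ∀ v, v ∈ c.candidate τ ↔ v ∈ c.candidate ρ

theorem polyDec_isOutput : PolyDec 50 GraphInput.IsOutput := by
  refine (polyDec_isFeasibleXYColoring polyRel_candidate).and (PolyDec.not
    (PolyDec.exTuple 50 (Q := fun c ρ τ => LexLT τ ρ ∧
      ∀ v, v ∈ c.candidate τ ↔ v ∈ c.candidate ρ) (PolyDec.and ?_ ?_)))
  · exact PolyDec.exFin fun i => (PolyDec.allFin fun j =>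
      (PolyDec.const (j < i)).imp (PolyDec.eq _ _)).and (PolyDec.lt _ _)
  · exact PolyDec.all ((polyRel_candidate _ _ _).iff (polyRel_candidate _ _ _))

theorem represents_inputStore (c : GraphInput) : Represents c (inputStore c.G c.x c.y) := by
  refine ⟨fun i j => ?_, ?_, ?_, ?_⟩ <;> simp [inputStore]

theorem exists_program : ∃ (prog : Prog) (p : Polynomial ℕ), ∀ c : GraphInput,
    IsSpider124Free c.G → c.G.Adj c.x c.y → AtMostOneInVertex c.G c.x c.y →
    ∃ (t : ℕ) (s : Store), Exec prog (inputStore c.G c.x c.y) t s ∧ t ≤ p.eval c.n ∧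
      (∀ k < outputLength s, IsFeasibleXYColoring c.G c.x c.y (outputSet c.n s k)) ∧
      ∀ B : Set (Fin c.n), IsFeasibleXYColoring c.G c.x c.y B →
        ∃! k, k < outputLength s ∧ outputSet c.n s k = B := by
  classical
  obtain ⟨g, ⟨prog, p, hp⟩, hg⟩ :=
    (PolyEmits.of_polyDec polyDec_isOutput polyRel_candidate).exists_forall
  refine ⟨prog, p, fun c hG hxy hin => ?_⟩
  let τ : Fin 0 → Fin c.n := fun i => i.elim0
  obtain ⟨t, s, hx, ht, -, -, hl⟩ := hp c τ _ [] (represents_inputStore c) (fun i => i.elim0)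
    ⟨by simp [outputLength, inputStore], fun k hk => absurd hk (by simp)⟩
  rw [List.nil_append] at hl
  have hmem : ∀ B, B ∈ g c τ ↔ ∃ ρ, c.IsOutput ρ ∧ B = c.candidate ρ := fun B => by
    rw [(hg c τ).1 B]
    refine exists_congr fun ρ => ?_
    by_cases h : c.IsOutput ρ <;> simp [h]
  -- Of two different tuples with the same candidate, the lexicographically larger one is rejected.
  have hnodup : (g c τ).Nodup := by
    refine (hg c τ).2 (fun ρ => ?_) fun ρ ρ' hne => ?_
    · split_ifs <;> simp
    · by_cases h : c.IsOutput ρ <;> by_cases h' : c.IsOutput ρ' <;> simp [h, h']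
      intro heq
      rcases LexLT.trichotomy hne with hlt | hlt
      · exact h'.2 ⟨ρ, hlt, fun v => by rw [heq]⟩
      · exact h.2 ⟨ρ', hlt, fun v => by rw [heq]⟩
  refine ⟨t, s, hx, ht, fun k hk => ?_, fun B hB => ?_⟩
  · rw [hl.length] at hk
    obtain ⟨ρ, hρ, h⟩ := (hmem _).1 (List.getElem_mem hk)
    rw [hl.row k hk, h]
    exact hρ.1
  -- The first tuple that decodes to $B$ passes the test; this is where the coding of every feasible
  -- coloring is used.
  · obtain ⟨ρ, hρ, hmin⟩ := LexLT.exists_min (c.exists_candidate hG hxy hin hB)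
    have hBg : B ∈ g c τ := (hmem B).2 ⟨ρ, ⟨by rwa [hρ], fun ⟨σ, hσ, h⟩ =>
      hmin σ hσ ((Set.ext h).trans hρ)⟩, hρ.symm⟩
    obtain ⟨k, hk, hkB⟩ := List.getElem_of_mem hBg
    refine ⟨k, ⟨by rwa [hl.length], by rw [hl.row k hk, hkB]⟩, fun k' ⟨hk', hkB'⟩ => ?_⟩
    rw [hl.length] at hk'
    rw [hl.row k' hk'] at hkB'
    exact (hnodup.getElem_inj_iff (hi := hk') (hj := hk)).1 (hkB'.trans hkB.symm)

theorem mainTheorem4 :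
    (∃ p : Polynomial ℕ, ∀ (V : Type*) [Fintype V] (G : SimpleGraph V) (x y : V),
      IsSpider124Free G → G.Adj x y → AtMostOneInVertex G x y →
      {B : Set V | IsFeasibleXYColoring G x y B}.ncard ≤ p.eval (Fintype.card V)) ∧
    (∃ (prog : Prog) (p : Polynomial ℕ), ∀ (n : ℕ) (G : SimpleGraph (Fin n)) (x y : Fin n),
      IsSpider124Free G → G.Adj x y → AtMostOneInVertex G x y →
      ∃ (t : ℕ) (s : Store), Exec prog (inputStore G x y) t s ∧ t ≤ p.eval n ∧
        (∀ k < outputLength s, IsFeasibleXYColoring G x y (outputSet n s k)) ∧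
        ∀ B : Set (Fin n), IsFeasibleXYColoring G x y B →
          ∃! k, k < outputLength s ∧ outputSet n s k = B) := by
  refine ⟨⟨Polynomial.X ^ 50, fun V _ G x y hG hxy hin => ?_⟩, ?_⟩
  · simpa using ncard_isFeasibleXYColoring_le hG hxy hin
  · obtain ⟨prog, p, h⟩ := exists_program
    exact ⟨prog, p, fun n G x y => h ⟨n, G, x, y⟩⟩
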